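/- Let $\mathbb N=\{1,2,3,\dots\}$. All linear equations are of the form $A:\ a_1x_1+\dots+a_kx_k=0$ with $a_1,\dots,a_k\in\mathbb Z\setminus\{0\}$; identify $A$ with the $1\times k$ matrix $(a_1,\dots,a_k)$. A solution is *$k$-distinct* if $x_1,\dots,x_k$ are pairwise distinct. The equation $A$ is *irredundant* if it has a $k$-distinct solution in $\mathbb N$, and *partition regular* if for every colouring of $\mathbb N$ with finitely many colours there is a monochromatic solution (not necessarily $k$-distinct) of $A$ in $\mathbb N$. For $\overline W\subseteq\{1,\dots,k\}$ let $A_{\overline W}$ be the matrix obtained from $A$ by keeping only the columns in $\overline W$ (with rank $0$ if $\overline W=\emptyset$). For linear equations $A$, $B$ on at least three variables, with $A$ on $k$ variables, put $$m(A)=\max_{\substack{W\,\dot\cup\,\overline W=\{1,\dots,k\}\\ |W|\ge 2}}\frac{|W|-1}{|W|-1+\operatorname{rank}(A_{\overline W})-\operatorname{rank}(A)},\qquad m(A,B)=\max_{\substack{W\,\dot\cup\,\overline W=\{1,\dots,k\}\\ |W|\ge 2}}\frac{|W|}{|W|-1+\operatorname{rank}(A_{\overline W})-\operatorname{rank}(A)+1/m(B)}.$$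 Given linear equations $A_1,\dots,A_r$, where $A_i$ has $k_i$ variables, a set $S$ of integers is *$(A_1,\dots,A_r)$-Rado* if for every colouring of $S$ with colours $1,\dots,r$ there is some $i$ and a $k_i$-distinct solution of $A_i$ in $S$ all of whose entries have colour $i$. Let $[n]_p$ denote the random subset of $\{1,\dots,n\}$ in which each element is included independently with probability $p$. **Corollary.** Let $r\ge 2$ and let $A_1,\dots,A_r$ be irredundant partition regular homogeneous linear equations, each on at least $3$ variables, with $m(A_1)\ge m(A_2)\ge\dots\ge m(A_r)$. Then there exists a constant $c>0$ such that for every sequence $p=p(n)\in[0,1]$ with $p(n)<c\,n^{-1/m(A_1,A_2)}$ for all sufficiently large $n$, $$\lim_{n\to\infty}\mathbb P\big[[n]_{p}\text{ is }(A_1,\dots,A_r)\text{-Rado}\big]=0.$$ -/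

import Mathlib

noncomputable section

namespace RandomRado

/-- The rank (over `ℚ`) of the matrix obtained from `A` by keeping only the columns outside `W`,
i.e. the columns indexed by the complement of `W`. -/
def rankCompl {l k : ℕ} (A : Matrix (Fin l) (Fin k) ℤ) (W : Finset (Fin k)) : ℕ :=
  ((A.map (Int.cast : ℤ → ℚ)).submatrix id (Subtype.val : {j : Fin k // j ∉ W} → Fin k)).rank

/-- The rank of an integer matrix over `ℚ`. -/
def rankQ {l k : ℕ} (A : Matrix (Fin l) (Fin k) ℤ) : ℕ :=
  (A.map (Int.cast : ℤ → ℚ)).rank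

/-- `m(A)`: the maximum, over all sets `W` of at least two columns, of
`(|W| - 1) / (|W| - 1 + rank (A restricted to the complement of W) - rank A)`.
The supremum is over a finite set, which is nonempty as soon as `k ≥ 2`. -/
def matrixM {l k : ℕ} (A : Matrix (Fin l) (Fin k) ℤ) : ℝ :=
  ⨆ W : {W : Finset (Fin k) // 2 ≤ W.card},
    ((W.1.card : ℝ) - 1) / ((W.1.card : ℝ) - 1 + (rankCompl A W.1 : ℝ) - (rankQ A : ℝ))

/-- `m(A, B)`: the maximum, over all sets `W` of at least two columns of `A`, of
`|W| / (|W| - 1 + rank (A restricted to the complement of W) - rank A + 1 / m(B))`. -/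
def matrixM₂ {l k l' k' : ℕ} (A : Matrix (Fin l) (Fin k) ℤ) (B : Matrix (Fin l') (Fin k') ℤ) : ℝ :=
  ⨆ W : {W : Finset (Fin k) // 2 ≤ W.card},
    (W.1.card : ℝ) / ((W.1.card : ℝ) - 1 + (rankCompl A W.1 : ℝ) - (rankQ A : ℝ) + 1 / matrixM B)

/-- A linear equation `a₁ x₁ + ⋯ + aₖ xₖ = b` with integer constant term and nonzero integer
coefficients. The number `k` of variables is `length`. -/
structure LinearEquation where
  length : ℕ
  coeff : Fin length → ℤ
  coeff_ne_zero : ∀ j, coeff j ≠ 0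
  const : ℤ

namespace LinearEquation

/-- The `1 × k` matrix of coefficients of a linear equation. -/
def underlyingMatrix (A : LinearEquation) : Matrix (Fin 1) (Fin A.length) ℤ :=
  Matrix.of fun _ j => A.coeff j

/-- `x` solves the equation. -/
def IsSolution (A : LinearEquation) (x : Fin A.length → ℤ) : Prop :=
  ∑ j, A.coeff j * x j = A.const

def IsHomogeneous (A : LinearEquation) : Prop :=
  A.const = 0

/-- There is a solution in pairwise distinct positive integers. -/
def Irredundant (A : LinearEquation) : Prop :=
  ∃ x : Fin A.length → ℤ, (∀ j, 0 < x j) ∧ Function.Injective x ∧ A.IsSolution x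

/-- Every colouring of the positive integers with finitely many colours has a monochromatic
(not necessarily distinct) solution. -/
def PartitionRegular (A : LinearEquation) : Prop :=
  ∀ (q : ℕ) (χ : {z : ℤ // 0 < z} → Fin q),
    ∃ x : Fin A.length → {z : ℤ // 0 < z},
      A.IsSolution (fun j => (x j : ℤ)) ∧ ∃ c : Fin q, ∀ j, χ (x j) = c

/-- `m(A)` for a linear equation. -/
def m (A : LinearEquation) : ℝ :=
  matrixM A.underlyingMatrix

/-- `m(A, B)` for two linear equations. -/
def m₂ (A B : LinearEquation) : ℝ :=
  matrixM₂ A.underlyingMatrix B.underlyingMatrix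

end LinearEquation

/-- The set `S` of integers is `(A₁, …, A_r)`-Rado: for every `r`-colouring of `S` there are a
colour `i` and a solution of `A_i` in pairwise distinct elements of `S`, all of colour `i`. -/
def IsRado {r : ℕ} (A : Fin r → LinearEquation) (S : Set ℤ) : Prop :=
  ∀ χ : S → Fin r, ∃ i : Fin r, ∃ x : Fin (A i).length → S,
    Function.Injective x ∧ (A i).IsSolution (fun j => (x j : ℤ)) ∧ ∀ j, χ (x j) = i

/-- The law of the random set `[n]_p`: each element of `{1, …, n}` is included independently
with probability `p`. -/
def randomSubset (n : ℕ) (p : unitInterval) : MeasureTheory.Measure (Set ℤ) :=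
  ProbabilityTheory.setBernoulli (Set.Icc (1 : ℤ) (n : ℤ)) p

end RandomRado

end

/-!
Only the colours of `A₁` and `A₂`, on `k ≤ l` variables, matter. Regard the distinct solutions of
`A₁` and `A₂` in a finite set `S` as `k`-edges and `l`-edges on `S`. If `S` is Rado, then every
2-colouring has an edge in its own colour, and in a minimal such system of edges an edge of the
other type passes through each vertex of each edge and meets it nowhere else.

The expected number of copies in `[n]_p` of a configuration of edges, with linearly independent
equations counted by the rank, is about `c ^ |V|` times `n` to a multiple of its weight
`l |V| - k (l - 1) rank`. Explore the minimal system edge by edge: for `k = l` attach single edges,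
and for `k < l` attach clusters, consisting of an `l`-edge and a `k`-edge through each of its
vertices. A step that meets the previous edges in a single vertex preserves the weight, and any
other step lowers it, so that after boundedly many such steps the weight is negative. Hence either
some configuration with at most about `log n` edges has negative weight, or the exploration reaches
`log n` edges with weight at most `k`, always attaching to one of boundedly many recent edges.
An exploration of length `j` can be continued in boundedly many ways at each step, so that for
small `c` the factor `c ^ |V|` leaves at most `exp (-j)` for all of them together; the final bounded
extension costs a power of `log n`. With `n ^ (-1 / (k (l - 1)))` in the first case, and with
`exp (-log n) n ^ (1 / (l - 1))` in the second, the expected number of configurations tends to `0`.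
-/

namespace RandomRado

open scoped Finset

section RelationSpace

variable {𝕜 V ι : Type*} [Field 𝕜] {vec : ι → V →₀ 𝕜} {e g : ι} {Γ Δ : List ι} {x : V →₀ 𝕜}

/-- The space of linear relations spanned by a list of edges. An edge `e : ι` stands for the linear
equation with coefficient vector `vec e`, and its vertices are the variables in the support of
`vec e`. -/
noncomputable def relSpace (vec : ι → V →₀ 𝕜) (Γ : List ι) : Submodule 𝕜 (V →₀ 𝕜) :=
  Submodule.span 𝕜 (vec '' {e | e ∈ Γ})

/-- The number of linearly independent equations in a list of edges. -/
noncomputable def relRank (vec : ι → V →₀ 𝕜) (Γ : List ι) : ℕ :=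
  Module.finrank 𝕜 (relSpace vec Γ)

instance finiteDimensional_relSpace : FiniteDimensional 𝕜 (relSpace vec Γ) :=
  .span_of_finite _ ((List.finite_toSet Γ).image vec)

theorem relSpace_nil : relSpace vec [] = ⊥ := by
  simp [relSpace]

theorem relSpace_cons : relSpace vec (e :: Γ) = Submodule.span 𝕜 {vec e} ⊔ relSpace vec Γ := by
  rw [relSpace, relSpace, ← Submodule.span_insert, ← Set.image_insert_eq]
  congr 2
  ext
  simp

theorem relSpace_mono (h : Γ ⊆ Δ) : relSpace vec Γ ≤ relSpace vec Δ :=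
  Submodule.span_mono (Set.image_mono h)

theorem mem_relSpace_cons :
    x ∈ relSpace vec (e :: Γ) ↔ ∃ a : 𝕜, ∃ y ∈ relSpace vec Γ, x = a • vec e + y := by
  rw [relSpace_cons, Submodule.mem_sup]
  simp only [Submodule.mem_span_singleton, exists_exists_eq_and, eq_comm (b := x)]

theorem relRank_nil : relRank vec [] = 0 := by
  rw [relRank, relSpace_nil, finrank_bot]

theorem relRank_mono (h : Γ ⊆ Δ) : relRank vec Γ ≤ relRank vec Δ :=
  Submodule.finrank_mono (relSpace_mono h)

theorem relRank_cons_of_notMem (he : vec e ∉ relSpace vec Γ) :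
    relRank vec (e :: Γ) = relRank vec Γ + 1 := by
  have h0 : vec e ≠ 0 := fun h => he (h ▸ Submodule.zero_mem _)
  have hdisj : Submodule.span 𝕜 {vec e} ⊓ relSpace vec Γ = ⊥ := by
    rw [← disjoint_iff, disjoint_comm, Submodule.disjoint_span_singleton' h0]
    exact he
  have hdim := Submodule.finrank_sup_add_finrank_inf_eq (Submodule.span 𝕜 {vec e}) (relSpace vec Γ)
  rw [hdisj, finrank_bot, finrank_span_singleton h0] at hdim
  rw [relRank, relSpace_cons, relRank]
  omega

theorem relRank_cons_of_mem (he : vec e ∈ relSpace vec Γ) :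
    relRank vec (e :: Γ) = relRank vec Γ := by
  rw [relRank, relSpace_cons, sup_eq_right.2 ((Submodule.span_singleton_le_iff_mem _ _).2 he),
    relRank]

theorem mul_apply_eq_of_mem_relSpace {w w' : V} (hx : x ∈ relSpace vec Γ)
    (hpriv : ∀ e ∈ Γ, e ≠ g → w ∉ (vec e).support ∧ w' ∉ (vec e).support) :
    x w * vec g w' = x w' * vec g w := by
  induction hx using Submodule.span_induction with
  | mem x hx =>
    obtain ⟨e, he, rfl⟩ := hx
    by_cases heg : e = g
    · rw [heg, mul_comm]
    · obtain ⟨hw, hw'⟩ := hpriv e he heg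
      rw [Finsupp.notMem_support_iff.1 hw, Finsupp.notMem_support_iff.1 hw', zero_mul, zero_mul]
  | zero => simp
  | add x y _ _ hx hy => simp [add_mul, hx, hy]
  | smul a x _ hx => simp [mul_assoc, hx]

/-- Every relation of `Γ` restricts to `{w, w'}` as a multiple of `vec g`. -/
theorem notMem_relSpace_of_private {w w' : V} (hw' : w' ∈ (vec g).support)
    (hpriv : ∀ e ∈ Γ, e ≠ g → w ∉ (vec e).support ∧ w' ∉ (vec e).support)
    (hxw : w ∈ x.support) (hxw' : w' ∉ x.support) : x ∉ relSpace vec Γ := by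
  intro hx
  have hzero := mul_apply_eq_of_mem_relSpace hx hpriv
  rw [Finsupp.notMem_support_iff.1 hxw', zero_mul] at hzero
  exact mul_ne_zero (Finsupp.mem_support_iff.1 hxw) (Finsupp.mem_support_iff.1 hw') hzero

end RelationSpace

section Weight

variable {𝕜 V ι : Type*} [Field 𝕜] [DecidableEq V] {vec : ι → V →₀ 𝕜} {e : ι} {Γ Δ : List ι}
  {x : V →₀ 𝕜} {v : V} {k l : ℕ}

theorem inter_eq_singleton_iff {s t : Finset V} :
    s ∩ t = {v} ↔ v ∈ s ∧ v ∈ t ∧ ∀ x ∈ s, x ∈ t → x = v := by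
  simp only [Finset.eq_singleton_iff_unique_mem, Finset.mem_inter, and_assoc, and_imp]

/-- The vertices covered by a list of edges. -/
def verts (vec : ι → V →₀ 𝕜) : List ι → Finset V
  | [] => ∅
  | e :: Γ => (vec e).support ∪ verts vec Γ

/-- A multiple of the exponent of `n` in the expected number of copies of `Γ` in `[n]_p`, where
`p = n ^ (-1 / m(A, B))` for equations `A` and `B` on `k ≤ l` variables: there are about
`n ^ (#(verts vec Γ) - relRank vec Γ)` copies of `Γ` in `[n]`, and the exponent is
`weight vec k l Γ / (k * (l - 1))`. -/
noncomputable def weight (vec : ι → V →₀ 𝕜) (k l : ℕ) (Γ : List ι) : ℤ :=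
  l * #(verts vec Γ) - k * (l - 1) * relRank vec Γ

theorem mem_verts : v ∈ verts vec Γ ↔ ∃ e ∈ Γ, v ∈ (vec e).support := by
  induction Γ with
  | nil => simp [verts]
  | cons e Γ ih => simp only [verts, Finset.mem_union, ih, List.exists_mem_cons_iff]

theorem verts_append : verts vec (Γ ++ Δ) = verts vec Γ ∪ verts vec Δ := by
  ext
  simp only [Finset.mem_union, mem_verts, List.mem_append, or_and_right, exists_or]

theorem verts_mono (h : Γ ⊆ Δ) : verts vec Γ ⊆ verts vec Δ := by
  intro v hv
  obtain ⟨e, he, hev⟩ := mem_verts.1 hv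
  exact mem_verts.2 ⟨e, h he, hev⟩

theorem support_subset_verts (he : e ∈ Γ) : (vec e).support ⊆ verts vec Γ :=
  fun _ hv => mem_verts.2 ⟨e, he, hv⟩

theorem support_subset_verts_of_mem_relSpace (hx : x ∈ relSpace vec Γ) :
    x.support ⊆ verts vec Γ := by
  induction hx using Submodule.span_induction with
  | mem x hx =>
    obtain ⟨e, he, rfl⟩ := hx
    exact support_subset_verts he
  | zero => simp
  | add x y _ _ hx hy => exact Finsupp.support_add.trans (Finset.union_subset hx hy)
  | smul a x _ hx => exact Finsupp.support_smul.trans hx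

theorem notMem_relSpace_of_notMem_verts (hx : v ∈ x.support) (hv : v ∉ verts vec Γ) :
    x ∉ relSpace vec Γ :=
  fun h => hv (support_subset_verts_of_mem_relSpace h hx)

theorem weight_nil : weight vec k l [] = 0 := by
  simp [weight, verts, relRank_nil]

theorem card_verts_cons : #(verts vec (e :: Γ)) =
    #(verts vec Γ) + #((vec e).support \ verts vec Γ) := by
  rw [verts, Finset.union_comm, ← Finset.union_sdiff_self_eq_union,
    Finset.card_union_of_disjoint Finset.disjoint_sdiff]

theorem weight_cons_of_notMem (he : vec e ∉ relSpace vec Γ) : weight vec k l (e :: Γ) =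
    weight vec k l Γ + l * #((vec e).support \ verts vec Γ) - k * (l - 1) := by
  rw [weight, weight, card_verts_cons, relRank_cons_of_notMem he]
  push_cast
  ring

theorem weight_cons_of_inter_eq_singleton {j : ℕ} (hcard : #(vec e).support = j) (hj : 2 ≤ j)
    (hv : (vec e).support ∩ verts vec Γ = {v}) :
    weight vec k l (e :: Γ) = weight vec k l Γ + l * (j - 1) - k * (l - 1) := by
  have hsplit := Finset.card_inter_add_card_sdiff (vec e).support (verts vec Γ)
  rw [hv, Finset.card_singleton, hcard] at hsplit
  obtain ⟨x, hx⟩ : ((vec e).support \ verts vec Γ).Nonempty := Finset.card_pos.1 (by omega)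
  rw [Finset.mem_sdiff] at hx
  rw [weight_cons_of_notMem (notMem_relSpace_of_notMem_verts hx.1 hx.2), ← hsplit]
  push_cast
  ring

theorem weight_cons_of_card_eq (hcard : #(vec e).support = k) (he : vec e ∉ relSpace vec Γ) :
    weight vec k k (e :: Γ) = weight vec k k Γ - k * (#((vec e).support ∩ verts vec Γ) - 1) := by
  have hsplit := Finset.card_inter_add_card_sdiff (vec e).support (verts vec Γ)
  rw [hcard] at hsplit
  rw [weight_cons_of_notMem he]
  zify at hsplit
  linear_combination (k : ℤ) * hsplit

end Weight

section LocalChain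

variable {𝕜 V ι : Type*} [Field 𝕜] [DecidableEq V] {vec : ι → V →₀ 𝕜} {W : ℕ} {c d h : List ι}

/-- The edge `e` meets the vertices of `Γ` in a single vertex, which lies in one of the first `W`
edges of `Γ`. As `W` does not depend on `Γ`, there are boundedly many ways of attaching an edge. -/
def Attaches (vec : ι → V →₀ 𝕜) (W : ℕ) (e : ι) (Γ : List ι) : Prop :=
  ∃ v ∈ verts vec (Γ.take W), (vec e).support ∩ verts vec Γ = {v}

/-- `c ++ h` arises from `h` by attaching the edges of `c` one after the other, the last one
first. -/
def IsLocalChain (vec : ι → V →₀ 𝕜) (W : ℕ) : List ι → List ι → Prop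
  | [], _ => True
  | e :: c, h => Attaches vec W e (c ++ h) ∧ IsLocalChain vec W c h

theorem IsLocalChain.append (hc : IsLocalChain vec W c h) (hd : IsLocalChain vec W d (c ++ h)) :
    IsLocalChain vec W (d ++ c) h := by
  induction d with
  | nil => exact hc
  | cons e d ih => exact ⟨List.append_assoc d c h ▸ hd.1, ih hd.2⟩

theorem IsLocalChain.length_le_card_verts (hc : IsLocalChain vec W c h)
    (htwo : ∀ e ∈ c, 2 ≤ #(vec e).support) : c.length ≤ #(verts vec (c ++ h)) := by
  induction c with
  | nil => simp
  | cons e c ih =>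
    obtain ⟨⟨v, -, hv⟩, hc⟩ := hc
    have ih := ih hc fun e he => htwo e (List.mem_cons_of_mem _ he)
    have hsplit := Finset.card_inter_add_card_sdiff (vec e).support (verts vec (c ++ h))
    have htwo := htwo e List.mem_cons_self
    rw [hv, Finset.card_singleton] at hsplit
    rw [List.cons_append, card_verts_cons, List.length_cons]
    omega

end LocalChain

section Exploration

variable {𝕜 V ι : Type*} [Field 𝕜] [DecidableEq V] {vec : ι → V →₀ 𝕜} {𝓐 : Finset ι}
  {k l W D L : ℕ} {c h Γ : List ι} {e : ι}

/-- A local chain of edges of `𝓐` that starts from a list of at most three edges of `𝓐`. -/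
structure IsExploration (vec : ι → V →₀ 𝕜) (W : ℕ) (𝓐 : Finset ι) (c h : List ι) : Prop where
  mem : ∀ e ∈ c ++ h, e ∈ 𝓐
  length_head_le : h.length ≤ 3
  isLocalChain : IsLocalChain vec W c h

/-- No extension of `Γ` by at most `D` edges of `𝓐` has negative weight. -/
def IsSparse (vec : ι → V →₀ 𝕜) (k l D : ℕ) (𝓐 : Finset ι) (Γ : List ι) : Prop :=
  ∀ t : List ι, t.length ≤ D → (∀ e ∈ t, e ∈ 𝓐) → 0 ≤ weight vec k l (t ++ Γ)

/-- Some exploration of length at most `L` can be extended by at most `D` edges to a configuration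
of negative weight. -/
def HasDenseConfig (vec : ι → V →₀ 𝕜) (k l W D L : ℕ) (𝓐 : Finset ι) : Prop :=
  ∃ c h : List ι, IsExploration vec W 𝓐 c h ∧ c.length ≤ L ∧ ¬ IsSparse vec k l D 𝓐 (c ++ h)

/-- Some exploration has length between `L` and `L + l`, and weight at most `k`. -/
def HasLongChain (vec : ι → V →₀ 𝕜) (k l W L : ℕ) (𝓐 : Finset ι) : Prop :=
  ∃ c h : List ι, IsExploration vec W 𝓐 c h ∧ L ≤ c.length ∧ c.length ≤ L + l ∧
    weight vec k l (c ++ h) ≤ k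

theorem isSparse_of_not_hasDenseConfig (hdense : ¬ HasDenseConfig vec k l W D L 𝓐)
    (hc : IsExploration vec W 𝓐 c h) (hL : c.length ≤ L) : IsSparse vec k l D 𝓐 (c ++ h) :=
  by_contra fun hsparse => hdense ⟨c, h, hc, hL, hsparse⟩

theorem IsSparse.append {n : ℕ} {s : List ι} (hΓ : IsSparse vec k l (D + n) 𝓐 Γ)
    (hs : s.length ≤ n) (hs𝓐 : ∀ e ∈ s, e ∈ 𝓐) : IsSparse vec k l D 𝓐 (s ++ Γ) := by
  intro t ht ht𝓐
  rw [← List.append_assoc]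
  refine hΓ (t ++ s) (by rw [List.length_append]; omega) fun e he => ?_
  exact (List.mem_append.1 he).elim (ht𝓐 e) (hs𝓐 e)

theorem IsSparse.cons (hΓ : IsSparse vec k l (D + 1) 𝓐 Γ) (he : e ∈ 𝓐) :
    IsSparse vec k l D 𝓐 (e :: Γ) :=
  hΓ.append (s := [e]) le_rfl (by simpa using he)

theorem IsSparse.weight_nonneg (hΓ : IsSparse vec k l D 𝓐 Γ) : 0 ≤ weight vec k l Γ :=
  hΓ [] (Nat.zero_le _) (by simp)

theorem IsExploration.mono {𝓑 : Finset ι} (hc : IsExploration vec W 𝓐 c h) (h𝓐 : 𝓐 ⊆ 𝓑) :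
    IsExploration vec W 𝓑 c h :=
  ⟨fun e he => h𝓐 (hc.mem e he), hc.length_head_le, hc.isLocalChain⟩

theorem IsSparse.anti {D' : ℕ} {𝓑 : Finset ι} (hΓ : IsSparse vec k l D 𝓑 Γ) (hD : D' ≤ D)
    (h𝓐 : 𝓐 ⊆ 𝓑) : IsSparse vec k l D' 𝓐 Γ :=
  fun t ht htA => hΓ t (ht.trans hD) fun e he => h𝓐 (htA e he)

theorem HasDenseConfig.mono {D' L' : ℕ} {𝓑 : Finset ι} (h𝓐 : HasDenseConfig vec k l W D L 𝓐)
    (hD : D ≤ D') (hL : L ≤ L') (hsub : 𝓐 ⊆ 𝓑) : HasDenseConfig vec k l W D' L' 𝓑 := by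
  obtain ⟨c, h, hc, hcL, hdense⟩ := h𝓐
  exact ⟨c, h, hc.mono hsub, hcL.trans hL, fun hsparse => hdense (hsparse.anti hD hsub)⟩

theorem HasLongChain.mono {𝓑 : Finset ι} (h𝓐 : HasLongChain vec k l W L 𝓐) (hsub : 𝓐 ⊆ 𝓑) :
    HasLongChain vec k l W L 𝓑 := by
  obtain ⟨c, h, hc, hlong⟩ := h𝓐
  exact ⟨c, h, hc.mono hsub, hlong⟩

end Exploration

section Unavoidable

variable {𝕜 V ι : Type*} [Field 𝕜] {vec : ι → V →₀ 𝕜} {τ : ι → Bool} {𝓐 : Finset ι} {e : ι}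
  {v : V}

/-- Every 2-colouring of the vertices has an edge `e` all of whose vertices have the colour
`τ e`. -/
def Unavoidable (vec : ι → V →₀ 𝕜) (τ : ι → Bool) (𝓐 : Finset ι) : Prop :=
  ∀ χ : V → Bool, ∃ e ∈ 𝓐, ∀ v ∈ (vec e).support, χ v = τ e

/-- Through each vertex of each edge of `𝓐` passes an edge of the other type that has no other
vertex in common with it. -/
def IsCrossing [DecidableEq V] (vec : ι → V →₀ 𝕜) (τ : ι → Bool) (𝓐 : Finset ι) : Prop :=
  ∀ e ∈ 𝓐, ∀ v ∈ (vec e).support,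
    ∃ f ∈ 𝓐, τ f ≠ τ e ∧ (vec e).support ∩ (vec f).support = {v}

theorem exists_coloring_of_minimal (h𝓐 : Minimal (Unavoidable vec τ) 𝓐) (he : e ∈ 𝓐) :
    ∃ χ : V → Bool, (∀ v ∈ (vec e).support, χ v = τ e) ∧
      ∀ f ∈ 𝓐, f ≠ e → ∃ v ∈ (vec f).support, χ v ≠ τ f := by
  classical
  have havoid := h𝓐.not_prop_of_lt (Finset.erase_ssubset he)
  simp only [Unavoidable, Finset.mem_erase, not_forall, not_exists, not_and] at havoid
  obtain ⟨χ, hχ⟩ := havoid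
  have hother : ∀ f ∈ 𝓐, f ≠ e → ∃ v ∈ (vec f).support, χ v ≠ τ f := fun f hf hfe => by
    simpa using hχ f ⟨hfe, hf⟩
  obtain ⟨f, hf, hfχ⟩ := h𝓐.prop χ
  obtain rfl : f = e := by
    by_contra hfe
    obtain ⟨v, hv, hne⟩ := hother f hf hfe
    exact hne (hfχ v hv)
  exact ⟨χ, hfχ, hother⟩

/-- Recolour `v` in a colouring in which `e` is the only monochromatic edge. -/
theorem isCrossing_of_minimal [DecidableEq V] (h𝓐 : Minimal (Unavoidable vec τ) 𝓐) :
    IsCrossing vec τ 𝓐 := by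
  intro e he v hv
  obtain ⟨χ, heχ, hother⟩ := exists_coloring_of_minimal h𝓐 he
  obtain ⟨f, hf, hfχ⟩ := h𝓐.prop (Function.update χ v (!τ e))
  have hfe : f ≠ e := by
    rintro rfl
    simpa using hfχ v hv
  have hvf : v ∈ (vec f).support := by
    by_contra hvf
    obtain ⟨x, hx, hne⟩ := hother f hf hfe
    rw [← hfχ x hx, Function.update_of_ne (ne_of_mem_of_not_mem hx hvf)] at hne
    exact hne rfl
  have hτ : τ f = !τ e := by simpa using (hfχ v hvf).symm
  refine ⟨f, hf, by simp [hτ], inter_eq_singleton_iff.2 ⟨hv, hvf, fun x hxe hxf => ?_⟩⟩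
  by_contra hxv
  have hcol := hfχ x hxf
  rw [Function.update_of_ne hxv, heχ x hxe, hτ] at hcol
  simp at hcol

/-- A colouring of the edges inside `X` and one of the edges outside `X` combine. -/
theorem exists_monochromatic_subset_of_minimal (h𝓐 : Minimal (Unavoidable vec τ) 𝓐) {X : Finset V}
    (hX : ∀ e ∈ 𝓐, (vec e).support ⊆ X ∨ Disjoint (vec e).support X) (he : e ∈ 𝓐)
    (heX : (vec e).support ⊆ X) (χ : V → Bool) :
    ∃ f ∈ 𝓐, (vec f).support ⊆ X ∧ ∀ v ∈ (vec f).support, χ v = τ f := by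
  classical
  obtain ⟨χ', -, hχ'⟩ := exists_coloring_of_minimal h𝓐 he
  obtain ⟨f, hf, hfχ⟩ := h𝓐.prop fun v => if v ∈ X then χ v else χ' v
  by_cases hfX : (vec f).support ⊆ X
  · exact ⟨f, hf, hfX, fun v hv => by simpa only [if_pos (hfX hv)] using hfχ v hv⟩
  · obtain ⟨v, hv, hne⟩ := hχ' f hf (by rintro rfl; exact hfX heX)
    have hvX : v ∉ X := Finset.disjoint_left.1 ((hX f hf).resolve_left hfX) hv
    exact absurd (by simpa only [if_neg hvX] using hfχ v hv) hne

end Unavoidable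

section FreeTip

variable {𝕜 V ι : Type*} [Field 𝕜] [DecidableEq V] {vec : ι → V →₀ 𝕜} {τ : ι → Bool}
  {𝓐 : Finset ι} {k W L : ℕ} {c h Γ : List ι} {e f g f₁ f₂ : ι} {x : V →₀ 𝕜} {P : Finset V}
  {u v w w' w₁ w₂ n : V}

theorem notMem_relSpace_cons_of_private (hw : w ∉ verts vec Γ) (hw'g : w' ∈ (vec g).support)
    (hw' : w' ∉ verts vec Γ) (hxw : w ∈ x.support) (hxw' : w' ∉ x.support) :
    x ∉ relSpace vec (g :: Γ) := by
  refine notMem_relSpace_of_private hw'g (fun e he heg => ?_) hxw hxw'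
  have heΓ := support_subset_verts (vec := vec) (List.mem_of_ne_of_mem heg he)
  exact ⟨fun h => hw (heΓ h), fun h => hw' (heΓ h)⟩

theorem card_inter_verts_le {j : ℕ} (hcard : #(vec e).support = k)
    (he : vec e ∉ relSpace vec Γ) (hnonneg : 0 ≤ weight vec k k (e :: Γ))
    (hj : weight vec k k Γ < k * j) : #((vec e).support ∩ verts vec Γ) ≤ j := by
  rw [weight_cons_of_card_eq hcard he] at hnonneg
  have hlt : (k : ℤ) * (#((vec e).support ∩ verts vec Γ) - 1) < k * j := by linarith
  have := lt_of_mul_lt_mul_left hlt (Int.natCast_nonneg k)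
  omega

/-- All but one of the vertices of the first edge lie on no other edge. -/
def HasFreeTip (vec : ι → V →₀ 𝕜) (k : ℕ) : List ι → Prop
  | [] => False
  | g :: Γ => ∃ P ⊆ (vec g).support, #P + 1 = k ∧ Disjoint P (verts vec Γ)

theorem hasFreeTip_cons (hcard : #(vec g).support = k) (hv : (vec g).support ∩ verts vec Γ = {v}) :
    HasFreeTip vec k (g :: Γ) := by
  have hsplit := Finset.card_inter_add_card_sdiff (vec g).support (verts vec Γ)
  rw [hv, Finset.card_singleton, hcard] at hsplit
  exact ⟨_, Finset.sdiff_subset, by omega, Finset.sdiff_disjoint⟩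

theorem notMem_relSpace_of_inter_eq_singleton (hP : P ⊆ (vec g).support) (htwo : 2 ≤ #P)
    (hPΓ : Disjoint P (verts vec Γ)) (hw : w ∈ P) (hf : (vec g).support ∩ (vec f).support = {w}) :
    vec f ∉ relSpace vec (g :: Γ) := by
  obtain ⟨-, hwf, hunique⟩ := inter_eq_singleton_iff.1 hf
  obtain ⟨w', hw', hne⟩ := Finset.exists_mem_ne htwo w
  exact notMem_relSpace_cons_of_private (Finset.disjoint_left.1 hPΓ hw) (hP hw')
    (Finset.disjoint_left.1 hPΓ hw') hwf fun h => hne (hunique w' (hP hw') h)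

theorem attaches_or_card_inter_eq_two (hcard : #(vec f).support = k) (hk : 3 ≤ k)
    (hP : P ⊆ (vec g).support) (hPcard : #P + 1 = k) (hPΓ : Disjoint P (verts vec Γ))
    (hweight : weight vec k k (g :: Γ) ≤ k) (hnonneg : 0 ≤ weight vec k k (f :: g :: Γ))
    (hw : w ∈ P) (hf : (vec g).support ∩ (vec f).support = {w}) :
    (vec f).support ∩ verts vec (g :: Γ) = {w} ∨
      #((vec f).support ∩ verts vec (g :: Γ)) = 2 ∧ weight vec k k (f :: g :: Γ) ≤ 0 ∧
        0 < weight vec k k (g :: Γ) := by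
  have hfg := notMem_relSpace_of_inter_eq_singleton hP (by omega) hPΓ hw hf
  have hle := card_inter_verts_le (j := 2) hcard hfg hnonneg (by push_cast; omega)
  have hmem : w ∈ (vec f).support ∩ verts vec (g :: Γ) := by
    obtain ⟨hwg, hwf, -⟩ := inter_eq_singleton_iff.1 hf
    exact Finset.mem_inter.2 ⟨hwf, support_subset_verts List.mem_cons_self hwg⟩
  have hpos := Finset.card_pos.2 ⟨w, hmem⟩
  obtain hone | htwo : #((vec f).support ∩ verts vec (g :: Γ)) = 1 ∨
      #((vec f).support ∩ verts vec (g :: Γ)) = 2 := by omega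
  · exact .inl (Finset.eq_singleton_iff_unique_mem.2
      ⟨hmem, fun v hv => Finset.card_le_one.1 hone.le v hv w hmem⟩)
  · have hcons := weight_cons_of_card_eq hcard hfg
    rw [htwo] at hcons
    push_cast at hcons
    exact .inr ⟨htwo, by linarith, by omega⟩

theorem mem_relSpace_of_card_inter_eq_two (hcard : #(vec f₂).support = k) (hk : 0 < k)
    (htwo : #((vec f₂).support ∩ verts vec (g :: Γ)) = 2)
    (hweight : weight vec k k (f₁ :: g :: Γ) ≤ 0)
    (hnonneg : 0 ≤ weight vec k k (f₂ :: f₁ :: g :: Γ)) :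
    vec f₂ ∈ relSpace vec (f₁ :: g :: Γ) := by
  by_contra hf
  have hle := card_inter_verts_le (j := 1) hcard hf hnonneg (by push_cast; omega)
  have hsub : verts vec (g :: Γ) ⊆ verts vec (f₁ :: g :: Γ) :=
    verts_mono (List.subset_cons_self _ _)
  have := Finset.card_le_card (Finset.inter_subset_inter (Finset.Subset.refl (vec f₂).support) hsub)
  omega

/-- Otherwise the two edges differ, up to scalars, by a relation of `g :: Γ` that distinguishes
two vertices of `P`. -/
theorem subset_pair_and_subset_of_mem_relSpace (hP : P ⊆ (vec g).support) (htwo : 2 ≤ #P)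
    (hPΓ : Disjoint P (verts vec Γ)) (hw₂ : w₂ ∈ P) (hw : w₁ ≠ w₂)
    (hf₁ : (vec g).support ∩ (vec f₁).support = {w₁})
    (hf₂ : (vec g).support ∩ (vec f₂).support = {w₂})
    (hmem : vec f₂ ∈ relSpace vec (f₁ :: g :: Γ)) :
    P ⊆ {w₁, w₂} ∧ (vec f₁).support \ verts vec (g :: Γ) ⊆ (vec f₂).support := by
  obtain ⟨a, y, hy, hsum⟩ := mem_relSpace_cons.1 hmem
  have hunique₁ := (inter_eq_singleton_iff.1 hf₁).2.2
  have hunique₂ := (inter_eq_singleton_iff.1 hf₂).2.2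
  have hw₂f₂ := (inter_eq_singleton_iff.1 hf₂).2.1
  have hyv (v : V) : y v = vec f₂ v - a * vec f₁ v := by simp [hsum]
  refine ⟨fun w hwP => ?_, fun n hn => ?_⟩
  · by_contra hw'
    simp only [Finset.mem_insert, Finset.mem_singleton, not_or] at hw'
    have hwf₁ : w ∉ (vec f₁).support := fun h => hw'.1 (hunique₁ w (hP hwP) h)
    have hwf₂ : w ∉ (vec f₂).support := fun h => hw'.2 (hunique₂ w (hP hwP) h)
    have hw₂f₁ : w₂ ∉ (vec f₁).support := fun h => hw (hunique₁ w₂ (hP hw₂) h).symm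
    refine notMem_relSpace_cons_of_private (Finset.disjoint_left.1 hPΓ hw₂) (hP hwP)
      (Finset.disjoint_left.1 hPΓ hwP) ?_ ?_ hy
    · rw [Finsupp.mem_support_iff, hyv, Finsupp.notMem_support_iff.1 hw₂f₁, mul_zero, sub_zero]
      exact Finsupp.mem_support_iff.1 hw₂f₂
    · rw [Finsupp.notMem_support_iff, hyv, Finsupp.notMem_support_iff.1 hwf₁,
        Finsupp.notMem_support_iff.1 hwf₂, mul_zero, sub_zero]
  · by_contra hnf₂
    rw [Finset.mem_sdiff, Finsupp.mem_support_iff] at hn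
    have hyn : y n = 0 := Finsupp.notMem_support_iff.1 fun h =>
      hn.2 (support_subset_verts_of_mem_relSpace hy h)
    rw [hyv, Finsupp.notMem_support_iff.1 hnf₂, zero_sub, neg_eq_zero] at hyn
    have ha : a = 0 := (mul_eq_zero.1 hyn).resolve_right hn.1
    rw [ha, zero_smul, zero_add] at hsum
    exact notMem_relSpace_of_inter_eq_singleton hP htwo hPΓ hw₂ hf₂ (hsum ▸ hy)

end FreeTip

section Triangle

variable {𝕜 V ι : Type*} [Field 𝕜] [DecidableEq V] {vec : ι → V →₀ 𝕜} {τ : ι → Bool}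
  {𝓐 : Finset ι} {k W L : ℕ} {c h Γ : List ι} {e f g f₁ f₂ : ι} {x : V →₀ 𝕜} {P : Finset V}
  {u v w w₁ w₂ n : V}

/-- Three edges on three vertices each, such that `f₁` and `f₂` meet in `n` and meet the edge
`g = {u, w₁, w₂}` in `w₁` and in `w₂`. This is the exceptional configuration that can block the
exploration of an equation with three variables. -/
structure IsTriangle (vec : ι → V →₀ 𝕜) (g f₁ f₂ : ι) (u w₁ w₂ n : V) : Prop where
  card_support : ∀ e ∈ [f₂, f₁, g], #(vec e).support = 3
  support_eq : (vec g).support = {u, w₁, w₂}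
  ne_left : u ≠ w₁
  ne_right : u ≠ w₂
  inter_left : (vec g).support ∩ (vec f₁).support = {w₁}
  inter_right : (vec g).support ∩ (vec f₂).support = {w₂}
  mem_left : n ∈ (vec f₁).support
  mem_right : n ∈ (vec f₂).support
  notMem : n ∉ (vec g).support

theorem exists_isTriangle (hcard : ∀ e ∈ [f₂, f₁, g], #(vec e).support = k) (hk : 3 ≤ k)
    (hP : P ⊆ (vec g).support) (hPcard : #P + 1 = k) (hw₁ : w₁ ∈ P) (hw₂ : w₂ ∈ P)
    (hf₁ : (vec g).support ∩ (vec f₁).support = {w₁})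
    (hf₂ : (vec g).support ∩ (vec f₂).support = {w₂})
    (htwo : #((vec f₁).support ∩ verts vec (g :: Γ)) = 2) (hpair : P ⊆ {w₁, w₂})
    (hsub : (vec f₁).support \ verts vec (g :: Γ) ⊆ (vec f₂).support) :
    k = 3 ∧ ∃ u n, IsTriangle vec g f₁ f₂ u w₁ w₂ n := by
  have hk3 : k = 3 := by
    have := (Finset.card_le_card hpair).trans Finset.card_le_two
    omega
  subst hk3
  have hgcard := hcard g (by simp)
  have hf₁card := hcard f₁ (by simp)
  obtain ⟨u, huP, hu⟩ := Finset.exists_eq_insert_iff.2 ⟨hP, by rw [hPcard, hgcard]⟩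
  have hPeq : P = {w₁, w₂} := by
    refine Finset.Subset.antisymm hpair ?_
    rintro v hv
    rcases Finset.mem_insert.1 hv with rfl | hv
    · exact hw₁
    · exact Finset.mem_singleton.1 hv ▸ hw₂
  obtain ⟨n, hn⟩ : ((vec f₁).support \ verts vec (g :: Γ)).Nonempty := by
    rw [← Finset.card_pos]
    have := Finset.card_inter_add_card_sdiff (vec f₁).support (verts vec (g :: Γ))
    omega
  exact ⟨rfl, u, n, hcard, by rw [← hu, hPeq], fun h => huP (h ▸ hw₁), fun h => huP (h ▸ hw₂),
    hf₁, hf₂, (Finset.mem_sdiff.1 hn).1, hsub hn,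
    fun h => (Finset.mem_sdiff.1 hn).2 (support_subset_verts List.mem_cons_self h)⟩

theorem card_support_add_card_support_le {y z : V →₀ 𝕜} {a b : 𝕜}
    (hyz : y.support ∩ z.support = {n}) (hn : (a • y + b • z) n = 0) (hne : a • y + b • z ≠ 0) :
    #y.support + #z.support ≤ #(a • y + b • z).support + 2 := by
  obtain ⟨hny, hnz, hunique⟩ := inter_eq_singleton_iff.1 hyz
  have hab : a ≠ 0 ∧ b ≠ 0 := by
    simp only [Finsupp.mem_support_iff] at hny hnz
    constructor
    · rintro rfl
      obtain rfl : b = 0 := by simpa [hnz] using hn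
      simp at hne
    · rintro rfl
      obtain rfl : a = 0 := by simpa [hny] using hn
      simp at hne
  have hsub : (y.support ∪ z.support).erase n ⊆ (a • y + b • z).support := by
    intro v hv
    obtain ⟨hvn, hv⟩ := Finset.mem_erase.1 hv
    have hnot := fun hy hz => hvn (hunique v hy hz)
    simp only [Finset.mem_union, Finsupp.mem_support_iff, Finsupp.coe_add, Finsupp.coe_smul,
      Pi.add_apply, Pi.smul_apply, smul_eq_mul] at hv hnot ⊢
    grind
  have hle := Finset.card_le_card hsub
  have hunion := Finset.card_union_add_card_inter y.support z.support
  rw [Finset.card_erase_of_mem (Finset.mem_union_left _ hny)] at hle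
  rw [hyz, Finset.card_singleton] at hunion
  omega

namespace IsTriangle

theorem notMem_support (hT : IsTriangle vec g f₁ f₂ u w₁ w₂ n) :
    u ∉ (vec f₁).support ∧ u ∉ (vec f₂).support := by
  have hu : u ∈ (vec g).support := by simp [hT.support_eq]
  exact ⟨fun h => hT.ne_left ((inter_eq_singleton_iff.1 hT.inter_left).2.2 u hu h),
    fun h => hT.ne_right ((inter_eq_singleton_iff.1 hT.inter_right).2.2 u hu h)⟩

theorem ne (hT : IsTriangle vec g f₁ f₂ u w₁ w₂ n) : w₁ ≠ w₂ := by
  rintro rfl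
  have := hT.card_support g (by simp)
  rw [hT.support_eq, Finset.pair_eq_singleton, Finset.card_pair hT.ne_left] at this
  omega

theorem right_notMem_support_left (hT : IsTriangle vec g f₁ f₂ u w₁ w₂ n) :
    w₂ ∉ (vec f₁).support := fun h =>
  hT.ne ((inter_eq_singleton_iff.1 hT.inter_left).2.2 w₂ (by simp [hT.support_eq]) h).symm

theorem notMem_relSpace (hT : IsTriangle vec g f₁ f₂ u w₁ w₂ n) :
    vec f₂ ∉ relSpace vec [f₁, g] := by
  refine notMem_relSpace_of_private (g := g) (w := w₂) (w' := u) (by simp [hT.support_eq]) ?_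
    (inter_eq_singleton_iff.1 hT.inter_right).2.1 hT.notMem_support.2
  intro e he heg
  obtain rfl : e = f₁ := by simpa [heg] using he
  exact ⟨hT.right_notMem_support_left, hT.notMem_support.1⟩

theorem weight_pair (hT : IsTriangle vec g f₁ f₂ u w₁ w₂ n) : weight vec 3 3 [f₁, g] = 3 := by
  have hg : vec g ∉ relSpace vec [] :=
    notMem_relSpace_of_notMem_verts (v := u) (by simp [hT.support_eq]) (by simp [verts])
  have hverts : verts vec [g] = (vec g).support := by simp [verts]
  have hf₁ : vec f₁ ∉ relSpace vec [g] :=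
    notMem_relSpace_of_notMem_verts hT.mem_left (hverts ▸ hT.notMem)
  rw [weight_cons_of_card_eq (hT.card_support f₁ (by simp)) hf₁,
    weight_cons_of_card_eq (hT.card_support g (by simp)) hg, weight_nil, hverts,
    Finset.inter_comm (vec f₁).support, hT.inter_left]
  simp [verts]

theorem pair_subset_inter_verts (hT : IsTriangle vec g f₁ f₂ u w₁ w₂ n) :
    {w₂, n} ⊆ (vec f₂).support ∩ verts vec [f₁, g] := by
  have hw₂ : w₂ ∈ (vec f₂).support ∩ verts vec [f₁, g] := Finset.mem_inter.2
    ⟨(inter_eq_singleton_iff.1 hT.inter_right).2.1,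
      mem_verts.2 ⟨g, by simp, by simp [hT.support_eq]⟩⟩
  have hn : n ∈ (vec f₂).support ∩ verts vec [f₁, g] :=
    Finset.mem_inter.2 ⟨hT.mem_right, mem_verts.2 ⟨f₁, by simp, hT.mem_left⟩⟩
  exact Finset.insert_subset hw₂ (Finset.singleton_subset_iff.2 hn)

theorem card_pair (hT : IsTriangle vec g f₁ f₂ u w₁ w₂ n) : #{w₂, n} = 2 :=
  Finset.card_pair fun h => hT.notMem (h ▸ by simp [hT.support_eq])

theorem weight_nonpos (hT : IsTriangle vec g f₁ f₂ u w₁ w₂ n) :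
    weight vec 3 3 [f₂, f₁, g] ≤ 0 := by
  rw [weight_cons_of_card_eq (hT.card_support f₂ (by simp)) hT.notMem_relSpace, hT.weight_pair]
  have := Finset.card_le_card hT.pair_subset_inter_verts
  rw [hT.card_pair] at this
  push_cast
  omega

theorem inter_support (hT : IsTriangle vec g f₁ f₂ u w₁ w₂ n)
    (hnonneg : 0 ≤ weight vec 3 3 [f₂, f₁, g]) :
    (vec f₁).support ∩ (vec f₂).support = {n} := by
  have hle := card_inter_verts_le (j := 2) (hT.card_support f₂ (by simp)) hT.notMem_relSpace
    hnonneg (by rw [hT.weight_pair]; norm_num)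
  have heq := Finset.eq_of_subset_of_card_le hT.pair_subset_inter_verts (hT.card_pair ▸ hle)
  refine inter_eq_singleton_iff.2 ⟨hT.mem_left, hT.mem_right, fun x hx₁ hx₂ => ?_⟩
  have hx : x ∈ ({w₂, n} : Finset V) :=
    heq ▸ Finset.mem_inter.2 ⟨hx₂, mem_verts.2 ⟨f₁, by simp, hx₁⟩⟩
  rcases Finset.mem_insert.1 hx with rfl | hx
  · exact absurd hx₁ hT.right_notMem_support_left
  · exact Finset.mem_singleton.1 hx

/-- A relation that avoids `u` is a combination of `vec f₁` and `vec f₂`; if it also avoids `n`,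
then its support contains the four other vertices of these edges. -/
theorem mem_support_or_mem_support (hT : IsTriangle vec g f₁ f₂ u w₁ w₂ n)
    (hnonneg : 0 ≤ weight vec 3 3 [f₂, f₁, g]) (hx : x ∈ relSpace vec [f₂, f₁, g])
    (hcard : #x.support = 3) : u ∈ x.support ∨ n ∈ x.support := by
  by_contra! hun
  obtain ⟨a, y, hy, rfl⟩ := mem_relSpace_cons.1 hx
  obtain ⟨b, z, hz, rfl⟩ := mem_relSpace_cons.1 hy
  obtain ⟨d, z', hz', rfl⟩ := mem_relSpace_cons.1 hz
  obtain rfl : z' = 0 := by rwa [relSpace_nil, Submodule.mem_bot] at hz'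
  have hgu : vec g u ≠ 0 := Finsupp.mem_support_iff.1 (by simp [hT.support_eq])
  obtain rfl : d = 0 := by
    simpa [Finsupp.notMem_support_iff.1 hT.notMem_support.1,
      Finsupp.notMem_support_iff.1 hT.notMem_support.2, hgu] using hun.1
  rw [zero_smul, add_zero, add_zero, add_comm] at hun hcard
  have hle := card_support_add_card_support_le (hT.inter_support hnonneg)
    (Finsupp.notMem_support_iff.1 hun.2) (by rintro h; simp [h] at hcard)
  rw [hT.card_support f₁ (by simp), hT.card_support f₂ (by simp)] at hle
  omega

end IsTriangle

end Triangle

section EqualLengths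

variable {𝕜 V ι : Type*} [Field 𝕜] [DecidableEq V] {vec : ι → V →₀ 𝕜} {τ : ι → Bool}
  {𝓐 : Finset ι} {k W L : ℕ} {c h Γ : List ι} {e f g f₁ f₂ : ι} {P : Finset V} {u v w₁ w₂ n : V}

theorem exists_attaches_or_isTriangle (h𝓐 : IsCrossing vec τ 𝓐)
    (hcard : ∀ e ∈ 𝓐, #(vec e).support = k) (hk : 3 ≤ k) (hg : g ∈ 𝓐)
    (hweight : weight vec k k (g :: Γ) ≤ k) (hsparse : IsSparse vec k k 2 𝓐 (g :: Γ))
    (htip : HasFreeTip vec k (g :: Γ)) :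
    (∃ f ∈ 𝓐, ∃ v ∈ (vec g).support, (vec f).support ∩ verts vec (g :: Γ) = {v}) ∨
      k = 3 ∧ 0 < weight vec k k (g :: Γ) ∧
        ∃ f₁ ∈ 𝓐, ∃ f₂ ∈ 𝓐, ∃ u w₁ w₂ n, IsTriangle vec g f₁ f₂ u w₁ w₂ n := by
  obtain ⟨P, hP, hPcard, hPΓ⟩ := htip
  have hPtwo : 2 ≤ #P := by omega
  obtain ⟨w₁, hw₁, w₂, hw₂, hne⟩ := Finset.one_lt_card.1 hPtwo
  obtain ⟨f₁, hf₁, -, hgf₁⟩ := h𝓐 g hg w₁ (hP hw₁)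
  obtain ⟨f₂, hf₂, -, hgf₂⟩ := h𝓐 g hg w₂ (hP hw₂)
  have hsparse₁ : IsSparse vec k k 1 𝓐 (f₁ :: g :: Γ) := hsparse.cons hf₁
  have hsparse₂ : IsSparse vec k k 1 𝓐 (f₂ :: g :: Γ) := hsparse.cons hf₂
  obtain h₁ | ⟨htwo₁, hweight₁, hpos⟩ := attaches_or_card_inter_eq_two (hcard f₁ hf₁) hk hP hPcard
    hPΓ hweight hsparse₁.weight_nonneg hw₁ hgf₁
  · exact .inl ⟨f₁, hf₁, w₁, hP hw₁, h₁⟩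
  obtain h₂ | ⟨htwo₂, -, -⟩ := attaches_or_card_inter_eq_two (hcard f₂ hf₂) hk hP hPcard
    hPΓ hweight hsparse₂.weight_nonneg hw₂ hgf₂
  · exact .inl ⟨f₂, hf₂, w₂, hP hw₂, h₂⟩
  have hmem := mem_relSpace_of_card_inter_eq_two (hcard f₂ hf₂) (by omega) htwo₂ hweight₁
    (hsparse₁.cons hf₂).weight_nonneg
  obtain ⟨hpair, hsub⟩ :=
    subset_pair_and_subset_of_mem_relSpace hP hPtwo hPΓ hw₂ hne hgf₁ hgf₂ hmem
  obtain ⟨hk3, u, n, hT⟩ := exists_isTriangle (by simp [hcard, hg, hf₁, hf₂]) hk hP hPcard hw₁ hw₂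
    hgf₁ hgf₂ htwo₁ hpair hsub
  exact .inr ⟨hk3, hpos, f₁, hf₁, f₂, hf₂, u, w₁, w₂, n, hT⟩

theorem IsExploration.cons (hc : IsExploration vec W 𝓐 c h) (he : e ∈ 𝓐)
    (hattach : Attaches vec W e (c ++ h)) : IsExploration vec W 𝓐 (e :: c) h where
  mem := by simpa only [List.cons_append, List.forall_mem_cons] using ⟨he, hc.mem⟩
  length_head_le := hc.length_head_le
  isLocalChain := ⟨hattach, hc.isLocalChain⟩

theorem exists_exploration_or_isTriangle (h𝓐 : IsCrossing vec τ 𝓐)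
    (hcard : ∀ e ∈ 𝓐, #(vec e).support = k) (hk : 3 ≤ k) (hW : 1 ≤ W)
    (hdense : ¬ HasDenseConfig vec k k W 2 L 𝓐) (hc : IsExploration vec W 𝓐 c h)
    (htip : HasFreeTip vec k (c ++ h)) (hweight : weight vec k k (c ++ h) ≤ k) (m : ℕ)
    (hm : c.length + m ≤ L + 1) :
    (∃ c', IsExploration vec W 𝓐 c' h ∧ c'.length = c.length + m ∧ HasFreeTip vec k (c' ++ h) ∧
      weight vec k k (c' ++ h) = weight vec k k (c ++ h)) ∨
    k = 3 ∧ 0 < weight vec k k (c ++ h) ∧ ∃ g ∈ 𝓐, ∃ f₁ ∈ 𝓐, ∃ f₂ ∈ 𝓐, ∃ u w₁ w₂ n,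
      IsTriangle vec g f₁ f₂ u w₁ w₂ n := by
  induction m with
  | zero => exact .inl ⟨c, hc, rfl, htip, rfl⟩
  | succ m ih =>
    obtain ⟨c', hc', hlength, htip', hweight'⟩ | hT := ih (by omega)
    swap
    · exact .inr hT
    have hsparse := isSparse_of_not_hasDenseConfig hdense hc' (by omega)
    obtain ⟨g, Γ, hgΓ⟩ : ∃ g Γ, c' ++ h = g :: Γ := by
      cases hlist : c' ++ h with
      | nil => simp [hlist, HasFreeTip] at htip'
      | cons g Γ => exact ⟨g, Γ, rfl⟩
    have hmem := hc'.mem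
    rw [hgΓ] at hmem htip' hsparse hweight'
    have hg := hmem g List.mem_cons_self
    obtain ⟨f, hf, v, hv, hinter⟩ | ⟨hk3, hpos, hT⟩ :=
      exists_attaches_or_isTriangle h𝓐 hcard hk hg (hweight' ▸ hweight) hsparse htip'
    · have hattach : Attaches vec W f (g :: Γ) :=
        ⟨v, mem_verts.2 ⟨g, by simp [List.take_cons hW], hv⟩, hinter⟩
      refine .inl ⟨f :: c', hc'.cons hf (hgΓ ▸ hattach), by rw [List.length_cons]; omega, ?_, ?_⟩
      · rw [List.cons_append, hgΓ]
        exact hasFreeTip_cons (hcard f hf) hinter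
      · rw [List.cons_append, hgΓ,
          weight_cons_of_inter_eq_singleton (hcard f hf) (by omega) hinter, add_sub_cancel_right,
          hweight']
    · exact .inr ⟨hk3, hweight' ▸ hpos, g, hg, hT⟩

theorem hasLongChain_or_isTriangle (h𝓐 : IsCrossing vec τ 𝓐)
    (hcard : ∀ e ∈ 𝓐, #(vec e).support = k) (hk : 3 ≤ k) (hW : 1 ≤ W)
    (hdense : ¬ HasDenseConfig vec k k W 2 L 𝓐) (hc : IsExploration vec W 𝓐 c h)
    (hlength : c.length ≤ 1) (htip : HasFreeTip vec k (c ++ h))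
    (hweight : weight vec k k (c ++ h) ≤ k) :
    HasLongChain vec k k W L 𝓐 ∨
    k = 3 ∧ 0 < weight vec k k (c ++ h) ∧ ∃ g ∈ 𝓐, ∃ f₁ ∈ 𝓐, ∃ f₂ ∈ 𝓐, ∃ u w₁ w₂ n,
      IsTriangle vec g f₁ f₂ u w₁ w₂ n :=
  (exists_exploration_or_isTriangle h𝓐 hcard hk hW hdense hc htip hweight L (by omega)).imp_left
    fun ⟨c', hc', hlength', _, hweight'⟩ =>
      ⟨c', h, hc', by omega, by omega, hweight'.trans_le hweight⟩

theorem IsTriangle.mem_relSpace_or_disjoint (hT : IsTriangle vec g f₁ f₂ u w₁ w₂ n)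
    (h𝓐 : IsCrossing vec τ 𝓐) (hcard : ∀ e ∈ 𝓐, #(vec e).support = 3) (hW : 3 ≤ W)
    (hmem : ∀ e ∈ [f₂, f₁, g], e ∈ 𝓐) (hdense : ¬ HasDenseConfig vec 3 3 W 2 L 𝓐)
    (hlong : ¬ HasLongChain vec 3 3 W L 𝓐) (he : e ∈ 𝓐) :
    vec e ∈ relSpace vec [f₂, f₁, g] ∨ Disjoint (vec e).support (verts vec [f₂, f₁, g]) := by
  have hexp : IsExploration vec W 𝓐 [] [f₂, f₁, g] := ⟨hmem, by simp, trivial⟩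
  have hsparse : IsSparse vec 3 3 2 𝓐 [f₂, f₁, g] :=
    isSparse_of_not_hasDenseConfig (c := []) hdense hexp (Nat.zero_le _)
  rw [or_iff_not_imp_left, Finset.disjoint_iff_inter_eq_empty, ← Finset.not_nonempty_iff_eq_empty]
  rintro hrel ⟨v, hv⟩
  have hle := card_inter_verts_le (j := 1) (hcard e he) hrel
    (IsSparse.weight_nonneg (hsparse.cons he)) (by have := hT.weight_nonpos; push_cast; omega)
  have hinter : (vec e).support ∩ verts vec [f₂, f₁, g] = {v} :=
    Finset.eq_singleton_iff_unique_mem.2 ⟨hv, fun x hx => Finset.card_le_one.1 hle x hx v hv⟩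
  have hattach : Attaches vec W e ([] ++ [f₂, f₁, g]) := by
    refine ⟨v, ?_, hinter⟩
    rw [List.nil_append, List.take_of_length_le (by simpa using hW)]
    exact (Finset.mem_inter.1 hv).2
  have hweight := weight_cons_of_inter_eq_singleton (k := 3) (l := 3) (hcard e he) (by norm_num)
    hinter
  have hnonpos := hT.weight_nonpos
  obtain hL | ⟨-, hpos, -⟩ := hasLongChain_or_isTriangle (c := [e]) h𝓐 hcard le_rfl (by omega)
    hdense (hexp.cons he hattach) le_rfl (hasFreeTip_cons (hcard e he) hinter)
    (by rw [List.singleton_append]; push_cast; omega)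
  · exact hlong hL
  · rw [List.singleton_append] at hpos
    omega

theorem IsTriangle.not_minimal (hT : IsTriangle vec g f₁ f₂ u w₁ w₂ n)
    (hnonneg : 0 ≤ weight vec 3 3 [f₂, f₁, g]) (hcard : ∀ e ∈ 𝓐, #(vec e).support = 3)
    (hg : g ∈ 𝓐) (hsplit : ∀ e ∈ 𝓐, vec e ∈ relSpace vec [f₂, f₁, g] ∨
      Disjoint (vec e).support (verts vec [f₂, f₁, g])) :
    ¬ Minimal (Unavoidable vec τ) 𝓐 := by
  intro h𝓐
  obtain ⟨f, hf, hfT, hfχ⟩ := exists_monochromatic_subset_of_minimal h𝓐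
    (fun e he => (hsplit e he).imp_left support_subset_verts_of_mem_relSpace) hg
    (support_subset_verts (by simp)) fun v => decide (v = u ∨ v = n)
  have hpos : (vec f).support.Nonempty := Finset.card_pos.1 (by rw [hcard f hf]; norm_num)
  have hrel := (hsplit f hf).resolve_right fun hdisj =>
    hpos.ne_empty (disjoint_self.1 (hdisj.mono_right hfT))
  cases hτ : τ f <;> simp only [hτ, decide_eq_true_eq, decide_eq_false_iff_not] at hfχ
  · rcases hT.mem_support_or_mem_support hnonneg hrel (hcard f hf) with hu | hn
    · exact hfχ u hu (.inl rfl)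
    · exact hfχ n hn (.inr rfl)
  · have hsub : (vec f).support ⊆ {u, n} := fun v hv => by simpa using hfχ v hv
    have := (Finset.card_le_card hsub).trans Finset.card_le_two
    rw [hcard f hf] at this
    omega

theorem hasLongChain_of_card_eq (h𝓐 : Minimal (Unavoidable vec τ) 𝓐)
    (hcard : ∀ e ∈ 𝓐, #(vec e).support = k) (hk : 3 ≤ k) (hW : 3 ≤ W)
    (hdense : ¬ HasDenseConfig vec k k W 2 L 𝓐) : HasLongChain vec k k W L 𝓐 := by
  by_contra hlong
  have hcross := isCrossing_of_minimal h𝓐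
  obtain ⟨e, he, -⟩ := h𝓐.prop fun _ => true
  obtain ⟨v, hv⟩ : (vec e).support.Nonempty := Finset.card_pos.1 (by rw [hcard e he]; omega)
  have htip : HasFreeTip vec k [e] := by
    refine ⟨(vec e).support.erase v, Finset.erase_subset _ _, ?_, by simp [verts]⟩
    rw [Finset.card_erase_add_one hv, hcard e he]
  have hweight : weight vec k k [e] = k := by
    rw [weight_cons_of_card_eq (hcard e he)
      (notMem_relSpace_of_notMem_verts hv (by simp [verts])), weight_nil]
    simp [verts]
  obtain hL | ⟨rfl, -, g, hg, f₁, hf₁, f₂, hf₂, u, w₁, w₂, n, hT⟩ :=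
    hasLongChain_or_isTriangle (c := []) (h := [e]) hcross hcard hk (by omega) hdense
      ⟨by simpa using he, by simp, trivial⟩ (by simp) htip hweight.le
  · exact hlong hL
  have hmem : ∀ e ∈ [f₂, f₁, g], e ∈ 𝓐 := by simp [hf₁, hf₂, hg]
  have hnonneg : 0 ≤ weight vec 3 3 [f₂, f₁, g] :=
    (isSparse_of_not_hasDenseConfig (c := []) hdense ⟨hmem, by simp, trivial⟩
      (Nat.zero_le _)).weight_nonneg
  exact hT.not_minimal hnonneg hcard hg
    (fun _ => hT.mem_relSpace_or_disjoint hcross hcard hW hmem hdense hlong) h𝓐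

end EqualLengths

section Cluster

variable {𝕜 V ι : Type*} [Field 𝕜] [DecidableEq V] {vec : ι → V →₀ 𝕜} {𝓐 : Finset ι}
  {k l W : ℕ} {Γ Δ : List ι} {F : ι} {E : V → ι} {u v w x : V}

/-- The vertices of `F` that are not covered by `Γ`. -/
abbrev newVerts (vec : ι → V →₀ 𝕜) (Γ : List ι) (F : ι) : Finset V :=
  (vec F).support \ verts vec Γ

/-- An edge `F` on `l` vertices, together with an edge `E u` on `k` vertices through each vertex
`u` of `F` that has no other vertex in common with `F`. -/
structure IsCluster (vec : ι → V →₀ 𝕜) (k l : ℕ) (𝓐 : Finset ι) (F : ι) (E : V → ι) : Prop where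
  mem : F ∈ 𝓐
  card_support : #(vec F).support = l
  mem_apply : ∀ u ∈ (vec F).support, E u ∈ 𝓐
  card_support_apply : ∀ u ∈ (vec F).support, #(vec (E u)).support = k
  inter_eq : ∀ u ∈ (vec F).support, (vec F).support ∩ (vec (E u)).support = {u}

/-- The edges of the cluster `F`, `E` are added to `Γ`, except for those `E u` for which `u` is
already covered by `Γ`. -/
noncomputable def addCluster (vec : ι → V →₀ 𝕜) (F : ι) (E : V → ι) (Γ : List ι) : List ι :=
  (newVerts vec Γ F).toList.map E ++ F :: Γ

/-- The vertices of the edge `E u` of a cluster other than `u`. -/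
def leaves (vec : ι → V →₀ 𝕜) (E : V → ι) (u : V) : Finset V :=
  (vec (E u)).support.erase u

/-- The vertices outside `F` that are added by `addCluster vec F E Γ`. -/
def outerVerts (vec : ι → V →₀ 𝕜) (F : ι) (E : V → ι) (Γ : List ι) : Finset V :=
  (newVerts vec Γ F).biUnion (leaves vec E) \ verts vec Γ

/-- The number of incidences between the added edges other than `F` and the vertices of `Γ`. -/
def backIncidences (vec : ι → V →₀ 𝕜) (F : ι) (E : V → ι) (Γ : List ι) : ℕ :=
  ∑ u ∈ newVerts vec Γ F, #(leaves vec E u ∩ verts vec Γ)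

/-- The added edges other than `F` are disjoint from each other and from the vertices of `Γ`. -/
def IsFree (vec : ι → V →₀ 𝕜) (F : ι) (E : V → ι) (Γ : List ι) : Prop :=
  (∀ u ∈ newVerts vec Γ F, Disjoint (vec (E u)).support (verts vec Γ)) ∧
    (newVerts vec Γ F : Set V).PairwiseDisjoint fun u => (vec (E u)).support

/-- Adding the cluster to `Γ` lowers the weight by at least `k - 1`, and by more than `k` unless the
cluster hardly meets `Γ`. Since `2 * (k - 1) > k`, an exploration of weight at most `k` cannot
absorb two degenerate clusters without becoming dense. -/
structure IsDegenerate (vec : ι → V →₀ 𝕜) (k l : ℕ) (F : ι) (E : V → ι) (Γ : List ι) : Prop where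
  weight_add_le : weight vec k l (addCluster vec F E Γ) + k ≤ weight vec k l Γ + 1
  lt_or_disjoint : weight vec k l (addCluster vec F E Γ) + k < weight vec k l Γ ∨
    #((vec F).support ∩ verts vec Γ) ≤ 2 ∧
      ∀ u ∈ newVerts vec Γ F, Disjoint (vec (E u)).support (verts vec Γ)

namespace IsCluster

theorem mem_support_apply (hE : IsCluster vec k l 𝓐 F E) (hu : u ∈ (vec F).support) :
    u ∈ (vec (E u)).support :=
  (inter_eq_singleton_iff.1 (hE.inter_eq u hu)).2.1

theorem eq_of_mem_support (hE : IsCluster vec k l 𝓐 F E) (hu : u ∈ (vec F).support)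
    (hx : x ∈ (vec F).support) (hxu : x ∈ (vec (E u)).support) : x = u :=
  (inter_eq_singleton_iff.1 (hE.inter_eq u hu)).2.2 x hx hxu

theorem notMem_support_of_mem_leaves (hE : IsCluster vec k l 𝓐 F E) (hu : u ∈ (vec F).support)
    (hx : x ∈ leaves vec E u) : x ∉ (vec F).support := fun hxF =>
  (Finset.mem_erase.1 hx).1 (hE.eq_of_mem_support hu hxF (Finset.mem_erase.1 hx).2)

theorem card_leaves (hE : IsCluster vec k l 𝓐 F E) (hu : u ∈ (vec F).support) :
    #(leaves vec E u) = k - 1 := by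
  rw [leaves, Finset.card_erase_of_mem (hE.mem_support_apply hu), hE.card_support_apply u hu]

theorem backIncidences_add_sum (hE : IsCluster vec k l 𝓐 F E) :
    backIncidences vec F E Γ +
      ∑ x ∈ outerVerts vec F E Γ, #{u ∈ newVerts vec Γ F | x ∈ leaves vec E u} =
      #(newVerts vec Γ F) * (k - 1) := by
  have hsdiff : ∀ u ∈ newVerts vec Γ F, leaves vec E u \ verts vec Γ =
      {x ∈ outerVerts vec F E Γ | x ∈ leaves vec E u} := by
    intro u hu
    ext x
    simp only [outerVerts, Finset.mem_filter, Finset.mem_sdiff, Finset.mem_biUnion]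
    exact ⟨fun hx => ⟨⟨⟨u, Finset.mem_sdiff.1 hu, hx.1⟩, hx.2⟩, hx.1⟩, fun hx => ⟨hx.2, hx.1.2⟩⟩
  have hdouble : ∑ x ∈ outerVerts vec F E Γ, #{u ∈ newVerts vec Γ F | x ∈ leaves vec E u} =
      ∑ u ∈ newVerts vec Γ F, #(leaves vec E u \ verts vec Γ) := by
    rw [Finset.sum_congr rfl fun u hu => congrArg Finset.card (hsdiff u hu)]
    exact (Finset.sum_card_bipartiteAbove_eq_sum_card_bipartiteBelow
      fun u x => x ∈ leaves vec E u).symm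
  rw [hdouble, backIncidences, ← Finset.sum_add_distrib, Finset.sum_const_nat fun u hu => ?_]
  rw [Finset.card_inter_add_card_sdiff, hE.card_leaves (Finset.mem_sdiff.1 hu).1]

end IsCluster

theorem one_le_card_filter_of_mem_outerVerts (hx : x ∈ outerVerts vec F E Γ) :
    1 ≤ #{u ∈ newVerts vec Γ F | x ∈ leaves vec E u} := by
  obtain ⟨u, hu, hxu⟩ := Finset.mem_biUnion.1 (Finset.mem_sdiff.1 hx).1
  exact Finset.card_pos.2 ⟨u, Finset.mem_filter.2 ⟨hu, hxu⟩⟩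

theorem disjoint_of_backIncidences_eq_zero (hzero : backIncidences vec F E Γ = 0)
    (hu : u ∈ newVerts vec Γ F) : Disjoint (vec (E u)).support (verts vec Γ) := by
  have hinter := Finset.card_eq_zero.1 (Finset.sum_eq_zero_iff.1 hzero u hu)
  refine Finset.disjoint_left.2 fun x hx hxΓ => ?_
  have hxu : x ≠ u := by
    rintro rfl
    exact (Finset.mem_sdiff.1 hu).2 hxΓ
  exact Finset.eq_empty_iff_forall_notMem.1 hinter x
    (Finset.mem_inter.2 ⟨Finset.mem_erase.2 ⟨hxu, hx⟩, hxΓ⟩)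

namespace IsCluster

theorem card_outerVerts_add_backIncidences_le (hE : IsCluster vec k l 𝓐 F E) :
    #(outerVerts vec F E Γ) + backIncidences vec F E Γ ≤ #(newVerts vec Γ F) * (k - 1) := by
  have hone := Finset.card_nsmul_le_sum (outerVerts vec F E Γ) _ 1
    fun x => one_le_card_filter_of_mem_outerVerts (x := x)
  rw [smul_eq_mul, mul_one] at hone
  have hcount := hE.backIncidences_add_sum (Γ := Γ)
  omega

theorem isFree_of_le (hE : IsCluster vec k l 𝓐 F E)
    (hle : #(newVerts vec Γ F) * (k - 1) ≤ #(outerVerts vec F E Γ)) : IsFree vec F E Γ := by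
  have hcount := hE.backIncidences_add_sum (Γ := Γ)
  have hback := hE.card_outerVerts_add_backIncidences_le (Γ := Γ)
  have hdisj := fun u => disjoint_of_backIncidences_eq_zero (vec := vec) (F := F) (E := E) (Γ := Γ)
    (u := u) (by omega)
  refine ⟨fun u => hdisj u, fun u hu u' hu' hne => Finset.disjoint_left.2 fun x hxu hxu' => ?_⟩
  have huF := (Finset.mem_sdiff.1 (Finset.mem_coe.1 hu)).1
  have huF' := (Finset.mem_sdiff.1 (Finset.mem_coe.1 hu')).1
  have hxleaf : x ∈ leaves vec E u :=
    Finset.mem_erase.2 ⟨fun h => hne (h ▸ hE.eq_of_mem_support huF' (h ▸ huF) hxu'), hxu⟩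
  have hxleaf' : x ∈ leaves vec E u' :=
    Finset.mem_erase.2 ⟨fun h => hne (h ▸ hE.eq_of_mem_support huF (h ▸ huF') hxu).symm, hxu'⟩
  have hlt : ∑ x ∈ outerVerts vec F E Γ, 1 <
      ∑ x ∈ outerVerts vec F E Γ, #{u ∈ newVerts vec Γ F | x ∈ leaves vec E u} := by
    refine Finset.sum_lt_sum (fun x => one_le_card_filter_of_mem_outerVerts) ⟨x, ?_, ?_⟩
    · exact Finset.mem_sdiff.2 ⟨Finset.mem_biUnion.2 ⟨u, hu, hxleaf⟩,
        Finset.disjoint_left.1 (hdisj u hu) hxu⟩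
    · exact Finset.one_lt_card.2 ⟨u, Finset.mem_filter.2 ⟨hu, hxleaf⟩, u',
        Finset.mem_filter.2 ⟨hu', hxleaf'⟩, hne⟩
  rw [← Finset.card_eq_sum_ones] at hlt
  omega

theorem card_verts_addCluster (hE : IsCluster vec k l 𝓐 F E) : #(verts vec (addCluster vec F E Γ)) =
    #(verts vec Γ) + #(newVerts vec Γ F) + #(outerVerts vec F E Γ) := by
  have hunion : verts vec (addCluster vec F E Γ) =
      (verts vec Γ ∪ newVerts vec Γ F) ∪ outerVerts vec F E Γ := by
    ext x
    simp only [addCluster, verts_append, verts, outerVerts, newVerts, leaves, Finset.mem_union,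
      mem_verts (Γ := List.map _ _), List.mem_map, Finset.mem_toList, Finset.mem_sdiff,
      Finset.mem_biUnion, Finset.mem_erase]
    grind
  have hdisj : Disjoint (verts vec Γ ∪ newVerts vec Γ F) (outerVerts vec F E Γ) := by
    refine Finset.disjoint_right.2 fun x hx hx' => ?_
    obtain ⟨hx, hxΓ⟩ := Finset.mem_sdiff.1 hx
    obtain ⟨u, hu, hxu⟩ := Finset.mem_biUnion.1 hx
    exact hE.notMem_support_of_mem_leaves (Finset.mem_sdiff.1 hu).1 hxu
      (Finset.mem_sdiff.1 ((Finset.mem_union.1 hx').resolve_left hxΓ)).1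
  rw [hunion, Finset.card_union_of_disjoint hdisj,
    Finset.card_union_of_disjoint Finset.disjoint_sdiff]

end IsCluster

theorem relRank_map_append {us : List V} (hnodup : us.Nodup) (hΓ : ∀ u ∈ us, u ∉ verts vec Γ)
    (hmem : ∀ u ∈ us, u ∈ (vec (E u)).support)
    (hne : ∀ u ∈ us, ∀ u' ∈ us, u ≠ u' → u ∉ (vec (E u')).support) :
    relRank vec (us.map E ++ Γ) = relRank vec Γ + us.length := by
  induction us with
  | nil => simp
  | cons u us ih =>
    rw [List.nodup_cons] at hnodup
    simp only [List.forall_mem_cons] at hΓ hmem hne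
    have hu : u ∉ verts vec (us.map E ++ Γ) := by
      rw [verts_append, Finset.mem_union, not_or]
      refine ⟨fun hmap => ?_, hΓ.1⟩
      obtain ⟨e, he, hue⟩ := mem_verts.1 hmap
      obtain ⟨u', hu', rfl⟩ := List.mem_map.1 he
      exact hne.1.2 u' hu' (fun h => hnodup.1 (h ▸ hu')) hue
    rw [List.map_cons, List.cons_append,
      relRank_cons_of_notMem (notMem_relSpace_of_notMem_verts hmem.1 hu),
      ih hnodup.2 hΓ.2 hmem.2 fun v hv v' hv' => (hne.2 v hv).2 v' hv', List.length_cons, add_assoc]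

namespace IsCluster

theorem relRank_map_append (hE : IsCluster vec k l 𝓐 F E) :
    relRank vec ((newVerts vec Γ F).toList.map E ++ Γ) = relRank vec Γ + #(newVerts vec Γ F) := by
  have hN : ∀ u ∈ (newVerts vec Γ F).toList, u ∈ (vec F).support ∧ u ∉ verts vec Γ := fun u hu =>
    Finset.mem_sdiff.1 (Finset.mem_toList.1 hu)
  rw [RandomRado.relRank_map_append (Finset.nodup_toList _) (fun u hu => (hN u hu).2)
    (fun u hu => hE.mem_support_apply (hN u hu).1)
    fun u hu u' hu' hne h => hne (hE.eq_of_mem_support (hN u' hu').1 (hN u hu).1 h),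
    Finset.length_toList]

end IsCluster

theorem relRank_addCluster : relRank vec (addCluster vec F E Γ) =
    relRank vec (F :: ((newVerts vec Γ F).toList.map E ++ Γ)) := by
  have hperm : (addCluster vec F E Γ).Perm (F :: ((newVerts vec Γ F).toList.map E ++ Γ)) :=
    List.perm_middle
  exact (relRank_mono hperm.subset).antisymm (relRank_mono hperm.symm.subset)

namespace IsCluster

/-- A vertex on only one of the edges `E u` would be private to `E u`, as `u` is, so that `vec F`,
which sees `u` but not that vertex, would not be spanned. -/
theorem two_le_card_filter_of_mem_relSpace (hE : IsCluster vec k l 𝓐 F E)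
    (hF : vec F ∈ relSpace vec ((newVerts vec Γ F).toList.map E ++ Γ))
    (hx : x ∈ outerVerts vec F E Γ) :
    2 ≤ #{u ∈ newVerts vec Γ F | x ∈ leaves vec E u} := by
  by_contra hlt
  obtain ⟨hx, hxΓ⟩ := Finset.mem_sdiff.1 hx
  obtain ⟨u, hu, hxu⟩ := Finset.mem_biUnion.1 hx
  obtain ⟨huF, huΓ⟩ := Finset.mem_sdiff.1 hu
  have hxF := hE.notMem_support_of_mem_leaves huF hxu
  have hone : #{u ∈ newVerts vec Γ F | x ∈ leaves vec E u} ≤ 1 := by omega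
  have hunique : ∀ u' ∈ newVerts vec Γ F, x ∈ leaves vec E u' → u' = u := fun u' hu' hxu' =>
    Finset.card_le_one.1 hone u' (Finset.mem_filter.2 ⟨hu', hxu'⟩) u
      (Finset.mem_filter.2 ⟨hu, hxu⟩)
  refine notMem_relSpace_of_private (Finset.mem_of_mem_erase hxu) (fun e he hne => ?_) huF hxF hF
  rcases List.mem_append.1 he with he | he
  · obtain ⟨u', hu', rfl⟩ := List.mem_map.1 he
    rw [Finset.mem_toList] at hu'
    have huF' := (Finset.mem_sdiff.1 hu').1
    have hne' : u' ≠ u := fun h => hne (h ▸ rfl)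
    exact ⟨fun h => hne' (hE.eq_of_mem_support huF' huF h).symm, fun h =>
      hne' (hunique u' hu' (Finset.mem_erase.2 ⟨fun hxu' => hxF (hxu' ▸ huF'), h⟩))⟩
  · exact ⟨fun h => huΓ (support_subset_verts he h), fun h => hxΓ (support_subset_verts he h)⟩

theorem two_mul_card_outerVerts_add_backIncidences_le (hE : IsCluster vec k l 𝓐 F E)
    (hF : vec F ∈ relSpace vec ((newVerts vec Γ F).toList.map E ++ Γ)) :
    2 * #(outerVerts vec F E Γ) + backIncidences vec F E Γ ≤ #(newVerts vec Γ F) * (k - 1) := by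
  have htwo := Finset.card_nsmul_le_sum (outerVerts vec F E Γ) _ 2
    fun x => hE.two_le_card_filter_of_mem_relSpace hF (x := x)
  rw [smul_eq_mul, mul_comm] at htwo
  have hcount := hE.backIncidences_add_sum (Γ := Γ)
  omega

theorem outerVerts_eq_empty (hE : IsCluster vec k l 𝓐 F E)
    (hF : vec F ∈ relSpace vec ((newVerts vec Γ F).toList.map E ++ Γ))
    (hone : #(newVerts vec Γ F) = 1) : outerVerts vec F E Γ = ∅ := by
  refine Finset.eq_empty_of_forall_notMem fun x hx => ?_
  have htwo := hE.two_le_card_filter_of_mem_relSpace hF hx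
  have hle := Finset.card_filter_le (newVerts vec Γ F) fun u => x ∈ leaves vec E u
  omega

theorem card_newVerts_add (hE : IsCluster vec k l 𝓐 F E) :
    #(newVerts vec Γ F) + #((vec F).support ∩ verts vec Γ) = l := by
  rw [add_comm, Finset.card_inter_add_card_sdiff, hE.card_support]

theorem weight_addCluster_of_notMem (hE : IsCluster vec k l 𝓐 F E)
    (hF : vec F ∉ relSpace vec ((newVerts vec Γ F).toList.map E ++ Γ)) :
    weight vec k l (addCluster vec F E Γ) = weight vec k l Γ -
      k * (#((vec F).support ∩ verts vec Γ) - 1) -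
      l * (#(newVerts vec Γ F) * (k - 1) - #(outerVerts vec F E Γ)) := by
  rw [weight, weight, hE.card_verts_addCluster, relRank_addCluster, relRank_cons_of_notMem hF,
    hE.relRank_map_append]
  have hl : (#(newVerts vec Γ F) + #((vec F).support ∩ verts vec Γ) : ℤ) = l :=
    mod_cast hE.card_newVerts_add
  push_cast
  linear_combination (k : ℤ) * hl

theorem weight_addCluster_of_mem (hE : IsCluster vec k l 𝓐 F E)
    (hF : vec F ∈ relSpace vec ((newVerts vec Γ F).toList.map E ++ Γ)) :
    weight vec k l (addCluster vec F E Γ) = weight vec k l Γ +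
      l * (#(newVerts vec Γ F) + #(outerVerts vec F E Γ)) -
      k * (l - 1) * #(newVerts vec Γ F) := by
  rw [weight, weight, hE.card_verts_addCluster, relRank_addCluster, relRank_cons_of_mem hF,
    hE.relRank_map_append]
  push_cast
  ring

theorem two_mul_weight_addCluster_le_of_mem (hE : IsCluster vec k l 𝓐 F E) (hk : 1 ≤ k)
    (hF : vec F ∈ relSpace vec ((newVerts vec Γ F).toList.map E ++ Γ)) :
    2 * weight vec k l (addCluster vec F E Γ) ≤ 2 * weight vec k l Γ -
      #(newVerts vec Γ F) * ((k - 1) * (l - 2) - 2) - l * backIncidences vec F E Γ := by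
  have hcount : (2 * #(outerVerts vec F E Γ) + backIncidences vec F E Γ : ℤ) ≤
      #(newVerts vec Γ F) * (k - 1) := by
    have hcount := hE.two_mul_card_outerVerts_add_backIncidences_le hF
    zify [hk] at hcount
    exact hcount
  have hmul := mul_le_mul_of_nonneg_left hcount (Int.natCast_nonneg l)
  rw [hE.weight_addCluster_of_mem hF]
  linarith

theorem isDegenerate_of_notMem (hE : IsCluster vec k l 𝓐 F E) (hk : 1 ≤ k) (hkl : k < l)
    (hF : vec F ∉ relSpace vec ((newVerts vec Γ F).toList.map E ++ Γ))
    (ht : 1 ≤ #((vec F).support ∩ verts vec Γ))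
    (hfree : ¬ (#((vec F).support ∩ verts vec Γ) = 1 ∧ IsFree vec F E Γ)) :
    IsDegenerate vec k l F E Γ := by
  have hle : #(outerVerts vec F E Γ) ≤ #(newVerts vec Γ F) * (k - 1) :=
    (Nat.le_add_right _ _).trans hE.card_outerVerts_add_backIncidences_le
  have hdrop := hE.weight_addCluster_of_notMem hF
  rw [← Nat.cast_pred hk] at hdrop
  rcases hle.eq_or_lt with heq | hlt
  · have hfree' := hE.isFree_of_le heq.ge
    have htwo : 2 ≤ #((vec F).support ∩ verts vec Γ) := by
      by_contra
      exact hfree ⟨by omega, hfree'⟩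
    rw [heq] at hdrop
    push_cast at hdrop
    rw [sub_self, mul_zero, sub_zero] at hdrop
    refine ⟨by nlinarith, ?_⟩
    rcases htwo.eq_or_lt with heq_two | hthree
    · exact .inr ⟨heq_two.ge, hfree'.1⟩
    · exact .inl (by nlinarith)
  · have hlt' : (#(outerVerts vec F E Γ) + 1 : ℤ) ≤ #(newVerts vec Γ F) * (k - 1 : ℕ) :=
      mod_cast hlt
    have hk' : 0 ≤ (k : ℤ) * (#((vec F).support ∩ verts vec Γ) - 1) :=
      mul_nonneg (by positivity) (by omega)
    have hl' : (l : ℤ) * 1 ≤ l * (#(newVerts vec Γ F) * (k - 1 : ℕ) - #(outerVerts vec F E Γ)) :=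
      mul_le_mul_of_nonneg_left (le_sub_iff_add_le'.2 hlt') (by positivity)
    exact ⟨by omega, .inl (by omega)⟩

theorem isDegenerate_of_mem (hE : IsCluster vec k l 𝓐 F E) (hk : 3 ≤ k) (hkl : k < l)
    (hF : vec F ∈ relSpace vec ((newVerts vec Γ F).toList.map E ++ Γ))
    (hN : (newVerts vec Γ F).Nonempty) (ht : 1 ≤ #((vec F).support ∩ verts vec Γ)) :
    IsDegenerate vec k l F E Γ := by
  rcases (Nat.one_le_iff_ne_zero.2 hN.card_ne_zero).eq_or_lt with hone | htwo
  · have hdrop := hE.weight_addCluster_of_mem hF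
    rw [hE.outerVerts_eq_empty hF hone.symm, ← hone, Finset.card_empty] at hdrop
    push_cast at hdrop
    have hlt : weight vec k l (addCluster vec F E Γ) + k < weight vec k l Γ := by nlinarith
    exact ⟨by omega, .inl hlt⟩
  have hdrop := hE.two_mul_weight_addCluster_le_of_mem (by omega) hF
  have hl := hE.card_newVerts_add (Γ := Γ)
  have hmul : (2 : ℤ) * ((k - 1) * (l - 2) - 2) ≤
      #(newVerts vec Γ F) * ((k - 1) * (l - 2) - 2) :=
    mul_le_mul_of_nonneg_right (by exact_mod_cast htwo) (by nlinarith)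
  have hback : 0 ≤ (l : ℤ) * backIncidences vec F E Γ := by positivity
  by_cases hspecial : k = 3 ∧ l = 4
  · obtain ⟨rfl, rfl⟩ := hspecial
    push_cast at *
    refine ⟨by push_cast; linarith, ?_⟩
    rcases Nat.eq_zero_or_pos (backIncidences vec F E Γ) with hzero | hpos
    · exact .inr ⟨by omega, fun u => disjoint_of_backIncidences_eq_zero hzero⟩
    · exact .inl (by omega)
  · have hbig : (k : ℤ) < (k - 1) * (l - 2) - 2 := by
      obtain hl5 | hk4 : 5 ≤ l ∨ 4 ≤ k := by omega
      · nlinarith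
      · nlinarith
    exact ⟨by linarith, .inl (by linarith)⟩

theorem isFree_or_isDegenerate (hE : IsCluster vec k l 𝓐 F E) (hk : 3 ≤ k) (hkl : k < l)
    (hN : (newVerts vec Γ F).Nonempty) (hwF : w ∈ (vec F).support) (hwΓ : w ∈ verts vec Γ) :
    ((vec F).support ∩ verts vec Γ = {w} ∧ IsFree vec F E Γ) ∨
      IsDegenerate vec k l F E Γ := by
  have hw : w ∈ (vec F).support ∩ verts vec Γ := Finset.mem_inter.2 ⟨hwF, hwΓ⟩
  have ht : 1 ≤ #((vec F).support ∩ verts vec Γ) := Finset.card_pos.2 ⟨w, hw⟩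
  by_cases hF : vec F ∈ relSpace vec ((newVerts vec Γ F).toList.map E ++ Γ)
  · exact .inr (hE.isDegenerate_of_mem hk hkl hF hN ht)
  by_cases hfree : #((vec F).support ∩ verts vec Γ) = 1 ∧ IsFree vec F E Γ
  · obtain ⟨x, hx⟩ := Finset.card_eq_one.1 hfree.1
    obtain rfl : w = x := Finset.mem_singleton.1 (hx ▸ hw)
    exact .inl ⟨hx, hfree.2⟩
  · exact .inr (hE.isDegenerate_of_notMem (by omega) hkl hF ht hfree)

theorem isFree_nil (hE : IsCluster vec k l 𝓐 F E) (hk : 3 ≤ k) (hkl : k < l)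
    (hnonneg : 0 ≤ weight vec k l (addCluster vec F E [])) : IsFree vec F E [] := by
  have ht : (vec F).support ∩ verts vec [] = ∅ := Finset.inter_empty _
  have hN : #(newVerts vec [] F) = l := by simpa [ht] using hE.card_newVerts_add (Γ := [])
  by_cases hF : vec F ∈ relSpace vec ((newVerts vec [] F).toList.map E ++ [])
  · have hdrop := hE.two_mul_weight_addCluster_le_of_mem (by omega) hF
    have hback : 0 ≤ (l : ℤ) * backIncidences vec F E [] := by positivity
    have hpos : (0 : ℤ) < (k - 1) * (l - 2) - 2 := by nlinarith
    have hmul : 0 < (l : ℤ) * ((k - 1) * (l - 2) - 2) := mul_pos (by omega) hpos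
    rw [hN, weight_nil] at hdrop
    linarith
  · have hdrop := hE.weight_addCluster_of_notMem hF
    rw [ht, hN, weight_nil, Finset.card_empty] at hdrop
    by_contra hfree
    have hlt : #(outerVerts vec F E []) < l * (k - 1) := by
      by_contra hle
      exact hfree (hE.isFree_of_le (by rw [hN]; omega))
    zify [(by omega : 1 ≤ k)] at hlt
    push_cast at hdrop
    nlinarith

end IsCluster

end Cluster

section FreeCluster

variable {𝕜 V ι : Type*} [Field 𝕜] [DecidableEq V] {vec : ι → V →₀ 𝕜} {𝓐 : Finset ι}
  {k l W D : ℕ} {c h Γ Δ : List ι} {F : ι} {E : V → ι} {w : V}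

theorem mem_addCluster {e : ι} : e ∈ addCluster vec F E Γ ↔
    (∃ u ∈ newVerts vec Γ F, E u = e) ∨ e = F ∨ e ∈ Γ := by
  simp only [addCluster, List.mem_append, List.mem_map, Finset.mem_toList, List.mem_cons]

theorem subset_addCluster : Γ ⊆ addCluster vec F E Γ :=
  fun _ he => mem_addCluster.2 (.inr (.inr he))

theorem IsCluster.forall_mem_addCluster (hE : IsCluster vec k l 𝓐 F E) (hΓ : ∀ e ∈ Γ, e ∈ 𝓐) :
    ∀ e ∈ addCluster vec F E Γ, e ∈ 𝓐 := by
  intro e he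
  rcases mem_addCluster.1 he with ⟨u, hu, rfl⟩ | rfl | he
  · exact hE.mem_apply u (Finset.mem_sdiff.1 hu).1
  · exact hE.mem
  · exact hΓ e he

theorem IsSparse.addCluster (hΓ : IsSparse vec k l (D + (l + 1)) 𝓐 Γ)
    (hE : IsCluster vec k l 𝓐 F E) : IsSparse vec k l D 𝓐 (addCluster vec F E Γ) := by
  have happend : RandomRado.addCluster vec F E Γ =
      ((newVerts vec Γ F).toList.map E ++ [F]) ++ Γ := by
    simp [RandomRado.addCluster]
  rw [happend]
  refine hΓ.append ?_ fun e he => ?_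
  · have hle := hE.card_newVerts_add (Γ := Γ)
    simp
    omega
  · rcases List.mem_append.1 he with he | he
    · obtain ⟨u, hu, rfl⟩ := List.mem_map.1 he
      exact hE.mem_apply u (Finset.mem_sdiff.1 (Finset.mem_toList.1 hu)).1
    · exact List.mem_singleton.1 he ▸ hE.mem

theorem IsFree.anti (hfree : IsFree vec F E Δ) (hw : (vec F).support ∩ verts vec Δ = {w})
    (hsub : Γ ⊆ Δ) (hwΓ : w ∈ verts vec Γ) :
    (vec F).support ∩ verts vec Γ = {w} ∧ IsFree vec F E Γ := by
  have hverts : verts vec Γ ⊆ verts vec Δ := verts_mono hsub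
  obtain ⟨hwF, -, hunique⟩ := inter_eq_singleton_iff.1 hw
  have hw' : (vec F).support ∩ verts vec Γ = {w} :=
    inter_eq_singleton_iff.2 ⟨hwF, hwΓ, fun x hx hxΓ => hunique x hx (hverts hxΓ)⟩
  have hN : newVerts vec Γ F = newVerts vec Δ F := by
    rw [newVerts, newVerts, ← Finset.sdiff_inter_self_left, hw', ← hw,
      Finset.sdiff_inter_self_left]
  exact ⟨hw', fun u hu => (hfree.1 u (hN ▸ hu)).mono_right hverts, hN ▸ hfree.2⟩

theorem IsFree.attaches (hfree : IsFree vec F E Γ) (hE : IsCluster vec k l 𝓐 F E) {u : V}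
    {us : List V} (hu : u ∈ newVerts vec Γ F) (hus : ∀ v ∈ us, v ∈ newVerts vec Γ F)
    (huus : u ∉ us) (hW : us.length < W) : Attaches vec W (E u) (us.map E ++ F :: Γ) := by
  have huF := (Finset.mem_sdiff.1 hu).1
  have hFtake : F ∈ (us.map E ++ F :: Γ).take W := by
    rw [List.append_cons, List.take_append, List.take_of_length_le (by simpa using hW)]
    simp
  refine ⟨u, mem_verts.2 ⟨F, hFtake, huF⟩, inter_eq_singleton_iff.2
    ⟨hE.mem_support_apply huF, mem_verts.2 ⟨F, by simp, huF⟩, fun x hx hxΓ => ?_⟩⟩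
  obtain ⟨e, he, hxe⟩ := mem_verts.1 hxΓ
  rcases List.mem_append.1 he with he | he
  · obtain ⟨v, hv, rfl⟩ := List.mem_map.1 he
    have hne : u ≠ v := fun h => huus (h ▸ hv)
    exact absurd hxe (Finset.disjoint_left.1 (hfree.2 hu (hus v hv) hne) hx)
  · rcases List.mem_cons.1 he with rfl | he
    · exact hE.eq_of_mem_support huF hxe hx
    · exact absurd (support_subset_verts he hxe) (Finset.disjoint_left.1 (hfree.1 u hu) hx)

theorem IsFree.isLocalChain (hfree : IsFree vec F E Γ) (hE : IsCluster vec k l 𝓐 F E)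
    (hW : #(newVerts vec Γ F) ≤ W) :
    IsLocalChain vec W ((newVerts vec Γ F).toList.map E) (F :: Γ) := by
  suffices hlist : ∀ us : List V, us.Nodup → (∀ u ∈ us, u ∈ newVerts vec Γ F) → us.length ≤ W →
      IsLocalChain vec W (us.map E) (F :: Γ) from
    hlist _ (Finset.nodup_toList _) (fun _ => Finset.mem_toList.1) (by simpa using hW)
  intro us hnodup hus hlength
  induction us with
  | nil => trivial
  | cons u us ih =>
    rw [List.nodup_cons] at hnodup
    rw [List.forall_mem_cons] at hus
    rw [List.length_cons] at hlength
    exact ⟨hfree.attaches hE hus.1 hus.2 hnodup.1 hlength, ih hnodup.2 hus.2 (by omega)⟩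

theorem IsLocalChain.weight_append (hc : IsLocalChain vec W c h)
    (hcard : ∀ e ∈ c, #(vec e).support = k) (hk : 2 ≤ k) :
    weight vec k l (c ++ h) = weight vec k l h - c.length * (l - k) := by
  induction c with
  | nil => simp
  | cons e c ih =>
    rw [List.forall_mem_cons] at hcard
    obtain ⟨⟨v, -, hv⟩, hc⟩ := hc
    rw [List.cons_append, weight_cons_of_inter_eq_singleton hcard.1 hk hv, ih hc hcard.2,
      List.length_cons]
    push_cast
    ring

theorem IsFree.weight_addCluster (hfree : IsFree vec F E Γ) (hE : IsCluster vec k l 𝓐 F E)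
    (hk : 2 ≤ k) : weight vec k l (addCluster vec F E Γ) =
      weight vec k l (F :: Γ) - #(newVerts vec Γ F) * (l - k) := by
  rw [addCluster, (hfree.isLocalChain hE le_rfl).weight_append ?_ hk, List.length_map,
    Finset.length_toList]
  intro e he
  obtain ⟨u, hu, rfl⟩ := List.mem_map.1 he
  exact hE.card_support_apply u (Finset.mem_sdiff.1 (Finset.mem_toList.1 hu)).1

theorem IsFree.weight_addCluster_eq (hfree : IsFree vec F E Γ) (hE : IsCluster vec k l 𝓐 F E)
    (hk : 2 ≤ k) (hl : 2 ≤ l) (hw : (vec F).support ∩ verts vec Γ = {w}) :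
    weight vec k l (addCluster vec F E Γ) = weight vec k l Γ := by
  have hN : (#(newVerts vec Γ F) + 1 : ℤ) = l := by
    simpa [hw] using congrArg ((↑) : ℕ → ℤ) (hE.card_newVerts_add (Γ := Γ))
  rw [hfree.weight_addCluster hE hk, weight_cons_of_inter_eq_singleton hE.card_support hl hw, ← hN]
  ring

theorem IsFree.weight_addCluster_nil (hfree : IsFree vec F E []) (hE : IsCluster vec k l 𝓐 F E)
    (hk : 2 ≤ k) (hl : 1 ≤ l) : weight vec k l (addCluster vec F E []) = k := by
  have hsdiff : (vec F).support \ verts vec [] = (vec F).support := Finset.sdiff_empty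
  obtain ⟨v, hv⟩ : (vec F).support.Nonempty := Finset.card_pos.1 (hE.card_support ▸ hl)
  have hF : vec F ∉ relSpace vec [] :=
    notMem_relSpace_of_notMem_verts hv (Finset.notMem_empty v)
  rw [hfree.weight_addCluster hE hk, weight_cons_of_notMem hF, weight_nil, newVerts, hsdiff,
    hE.card_support]
  ring

end FreeCluster

section Branch

variable {𝕜 V ι : Type*} [Field 𝕜] [DecidableEq V] {vec : ι → V →₀ 𝕜} {𝓐 : Finset ι}
  {k l W D : ℕ} {Γ : List ι} {B F : ι} {E : V → ι} {P : Finset V}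

/-- The edge `B` of `Γ` has `k` vertices, and the vertices in `P`, of which there are at least two,
lie on no other edge of `Γ`. -/
structure IsBranch (vec : ι → V →₀ 𝕜) (k : ℕ) (Γ : List ι) (B : ι) (P : Finset V) : Prop where
  mem : B ∈ Γ
  card_support : #(vec B).support = k
  subset : P ⊆ (vec B).support
  one_lt_card : 1 < #P
  disjoint : ∀ e ∈ Γ, e ≠ B → Disjoint P (vec e).support

/-- There are at least three branches among the first `W` edges of `Γ`. -/
def HasBranches (vec : ι → V →₀ 𝕜) (k W : ℕ) (Γ : List ι) : Prop :=
  ∃ 𝓑 : Finset ι, ∃ P : ι → Finset V, 3 ≤ #𝓑 ∧ ∀ B ∈ 𝓑, B ∈ Γ.take W ∧ IsBranch vec k Γ B (P B)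

/-- Every vertex of every edge on `k` vertices of `𝓐` is the only one that this edge shares with the
edge on `l` vertices of some cluster. -/
def HasClusters (vec : ι → V →₀ 𝕜) (k l : ℕ) (𝓐 : Finset ι) : Prop :=
  ∀ B ∈ 𝓐, #(vec B).support = k → ∀ w ∈ (vec B).support,
    ∃ F E, IsCluster vec k l 𝓐 F E ∧ (vec B).support ∩ (vec F).support = {w}

theorem IsFree.isBranch_leaves (hfree : IsFree vec F E Γ) (hE : IsCluster vec k l 𝓐 F E)
    (hk : 3 ≤ k) {u : V} (hu : u ∈ newVerts vec Γ F) :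
    IsBranch vec k (addCluster vec F E Γ) (E u) (leaves vec E u) := by
  have huF := (Finset.mem_sdiff.1 hu).1
  refine ⟨mem_addCluster.2 (.inl ⟨u, hu, rfl⟩), hE.card_support_apply u huF,
    Finset.erase_subset _ _, by rw [hE.card_leaves huF]; omega, fun e he hne => ?_⟩
  rcases mem_addCluster.1 he with ⟨v, hv, rfl⟩ | rfl | he
  · exact (hfree.2 hu hv fun h => hne (h ▸ rfl)).mono_left (Finset.erase_subset _ _)
  · exact Finset.disjoint_left.2 fun _ => hE.notMem_support_of_mem_leaves huF
  · exact (hfree.1 u hu).mono (Finset.erase_subset _ _) (support_subset_verts he)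

theorem IsFree.hasBranches (hfree : IsFree vec F E Γ) (hE : IsCluster vec k l 𝓐 F E) (hk : 3 ≤ k)
    (hN : 3 ≤ #(newVerts vec Γ F)) (hW : #(newVerts vec Γ F) ≤ W) :
    HasBranches vec k W (addCluster vec F E Γ) := by
  classical
  have hinj : Set.InjOn E (newVerts vec Γ F) := by
    intro u hu v hv huv
    have huF := (Finset.mem_sdiff.1 (Finset.mem_coe.1 hu)).1
    have hvF := (Finset.mem_sdiff.1 (Finset.mem_coe.1 hv)).1
    exact hE.eq_of_mem_support hvF huF (huv ▸ hE.mem_support_apply huF)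
  have : Nonempty V := ⟨(Finset.card_pos.1 (by omega : 0 < #(newVerts vec Γ F))).choose⟩
  refine ⟨(newVerts vec Γ F).image E,
    fun B => leaves vec E (Function.invFunOn E (newVerts vec Γ F) B),
    by rwa [Finset.card_image_of_injOn hinj], Finset.forall_mem_image.2 fun u hu => ⟨?_, ?_⟩⟩
  · rw [addCluster, List.take_append, List.take_of_length_le (by simpa using hW)]
    exact List.mem_append_left _ (List.mem_map.2 ⟨u, Finset.mem_toList.2 hu, rfl⟩)
  · beta_reduce
    rw [hinj.leftInvOn_invFunOn hu]
    exact hfree.isBranch_leaves hE hk hu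

namespace IsBranch

theorem notMem_relSpace (hB : IsBranch vec k Γ B P) {w : V} (hw : w ∈ P)
    (hF : (vec B).support ∩ (vec F).support = {w}) : vec F ∉ relSpace vec Γ := by
  obtain ⟨-, hwF, hunique⟩ := inter_eq_singleton_iff.1 hF
  obtain ⟨w', hw', hne⟩ := Finset.exists_mem_ne hB.one_lt_card w
  exact notMem_relSpace_of_private (hB.subset hw')
    (fun e he heB => ⟨Finset.disjoint_left.1 (hB.disjoint e he heB) hw,
      Finset.disjoint_left.1 (hB.disjoint e he heB) hw'⟩)
    hwF fun h => hne (hunique w' (hB.subset hw') h)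

theorem exists_isCluster (hB : IsBranch vec k Γ B P) (hcl : HasClusters vec k l 𝓐) (hk : 1 ≤ k)
    (hl : 3 ≤ l) (hΓ : ∀ e ∈ Γ, e ∈ 𝓐) (hsparse : IsSparse vec k l (D + 1) 𝓐 Γ)
    (hweight : weight vec k l Γ ≤ k) :
    ∃ F E, IsCluster vec k l 𝓐 F E ∧ (newVerts vec Γ F).Nonempty ∧
      ∃ w ∈ (vec B).support, w ∈ (vec F).support := by
  obtain ⟨w, hw⟩ := Finset.card_pos.1 (zero_lt_one.trans hB.one_lt_card)
  obtain ⟨F, E, hE, hBF⟩ := hcl B (hΓ B hB.mem) hB.card_support w (hB.subset hw)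
  refine ⟨F, E, hE, ?_, w, hB.subset hw, (inter_eq_singleton_iff.1 hBF).2.1⟩
  by_contra hempty
  have hsdiff : (vec F).support \ verts vec Γ = ∅ := Finset.not_nonempty_iff_eq_empty.1 hempty
  have hnonneg := (hsparse.cons hE.mem).weight_nonneg
  rw [weight_cons_of_notMem (hB.notMem_relSpace hw hBF), hsdiff, Finset.card_empty] at hnonneg
  push_cast at hnonneg
  nlinarith

theorem addCluster (hB : IsBranch vec k Γ B P) (hF : Disjoint P (vec F).support)
    (hE : ∀ u ∈ newVerts vec Γ F, Disjoint (vec (E u)).support (verts vec Γ)) :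
    IsBranch vec k (addCluster vec F E Γ) B P := by
  refine { hB with mem := subset_addCluster hB.mem, disjoint := fun e he hne => ?_ }
  rcases mem_addCluster.1 he with ⟨u, hu, rfl⟩ | rfl | he
  · exact ((hE u hu).mono_right (hB.subset.trans (support_subset_verts hB.mem))).symm
  · exact hF
  · exact hB.disjoint e he hne

end IsBranch

theorem exists_branch_disjoint {𝓑 : Finset ι} {P : ι → Finset V} {s : Finset V}
    (h𝓑 : ∀ B ∈ 𝓑, IsBranch vec k Γ B (P B)) (hcard : #(s ∩ verts vec Γ) < #𝓑) :
    ∃ B ∈ 𝓑, Disjoint (P B) s := by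
  classical
  by_contra! hmeet
  simp only [Finset.not_disjoint_iff] at hmeet
  obtain ⟨B, hB⟩ := Finset.card_pos.1 (Nat.zero_lt_of_lt hcard)
  have : Nonempty V := ⟨(hmeet B hB).choose⟩
  choose! x hxP hxs using hmeet
  refine absurd (Finset.card_le_card_of_injOn x (fun B hB => ?_) fun B hB C hC hxx => ?_)
    hcard.not_ge
  · exact Finset.mem_coe.2 (Finset.mem_inter.2 ⟨hxs B hB,
      support_subset_verts (h𝓑 B hB).mem ((h𝓑 B hB).subset (hxP B hB))⟩)
  · by_contra hne
    exact Finset.disjoint_left.1 ((h𝓑 B hB).disjoint C (h𝓑 C hC).mem (Ne.symm hne)) (hxP B hB)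
      (hxx ▸ (h𝓑 C hC).subset (hxP C hC))

/-- Otherwise the clusters through two suitable branches are both degenerate. -/
theorem exists_free_cluster (hcl : HasClusters vec k l 𝓐) (hk : 3 ≤ k) (hkl : k < l)
    (hΓ : ∀ e ∈ Γ, e ∈ 𝓐) (hbranches : HasBranches vec k W Γ) (hweight : weight vec k l Γ ≤ k)
    (hsparse : IsSparse vec k l (2 * l + 2) 𝓐 Γ) :
    ∃ F E, IsCluster vec k l 𝓐 F E ∧ Attaches vec W F Γ ∧ IsFree vec F E Γ := by
  obtain ⟨𝓑, P, hthree, h𝓑⟩ := hbranches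
  by_contra! hnone
  have hdegenerate : ∀ {F E B w} {Δ : List ι}, IsCluster vec k l 𝓐 F E → B ∈ 𝓑 →
      w ∈ (vec B).support → w ∈ (vec F).support → Γ ⊆ Δ → (newVerts vec Δ F).Nonempty →
      IsDegenerate vec k l F E Δ := by
    intro F E B w Δ hE hB hwB hwF hΓΔ hN
    have hwΓ : w ∈ verts vec Γ := support_subset_verts (h𝓑 B hB).2.mem hwB
    refine (hE.isFree_or_isDegenerate hk hkl hN hwF (verts_mono hΓΔ hwΓ)).resolve_left ?_
    rintro ⟨hw, hfree⟩
    obtain ⟨hw', hfree'⟩ := hfree.anti hw hΓΔ hwΓ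
    exact hnone F E hE ⟨w, support_subset_verts (h𝓑 B hB).1 hwB, hw'⟩ hfree'
  have hsparse' : IsSparse vec k l (l + 1 + (l + 1)) 𝓐 Γ := hsparse.anti (by omega) subset_rfl
  obtain ⟨B₁, hB₁⟩ := Finset.card_pos.1 (by omega : 0 < #𝓑)
  obtain ⟨F₁, E₁, hE₁, hN₁, w₁, hwB₁, hwF₁⟩ := (h𝓑 B₁ hB₁).2.exists_isCluster hcl (by omega)
    (by omega) hΓ hsparse' hweight
  have hdeg₁ := hdegenerate hE₁ hB₁ hwB₁ hwF₁ (List.Subset.refl Γ) hN₁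
  have hsparse₁ := hsparse'.addCluster hE₁
  have hnonneg₁ := hsparse₁.weight_nonneg
  obtain ⟨htwo, hdisj⟩ := hdeg₁.lt_or_disjoint.resolve_left (by omega)
  obtain ⟨B₂, hB₂, hPF₁⟩ := exists_branch_disjoint (fun B hB => (h𝓑 B hB).2)
    (htwo.trans_lt hthree)
  have hweight₁ := hdeg₁.weight_add_le
  have hbranch₂ := (h𝓑 B₂ hB₂).2.addCluster hPF₁ hdisj
  obtain ⟨F₂, E₂, hE₂, hN₂, w₂, hwB₂, hwF₂⟩ := hbranch₂.exists_isCluster hcl (by omega) (by omega)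
    (hE₁.forall_mem_addCluster hΓ) hsparse₁ (by omega)
  have hweight₂ := (hdegenerate hE₂ hB₂ hwB₂ hwF₂ subset_addCluster hN₂).weight_add_le
  have hnonneg₂ := (IsSparse.addCluster (D := 0) (by simpa using hsparse₁) hE₂).weight_nonneg
  omega

end Branch

section UnequalLengths

variable {𝕜 V ι : Type*} [Field 𝕜] [DecidableEq V] {vec : ι → V →₀ 𝕜} {τ : ι → Bool}
  {𝓐 : Finset ι} {k l L W : ℕ} {c h : List ι} {F : ι} {E : V → ι}

/-- An exploration of weight `k` that can be continued by another cluster, unless it can be made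
dense. -/
structure IsClusterChain (vec : ι → V →₀ 𝕜) (k l W : ℕ) (𝓐 : Finset ι) (c h : List ι) : Prop
    extends IsExploration vec W 𝓐 c h where
  weight_eq : weight vec k l (c ++ h) = k
  hasBranches : HasBranches vec k W (c ++ h)

theorem IsCrossing.exists_isCluster (h𝓐 : IsCrossing vec τ 𝓐)
    (hcard : ∀ e ∈ 𝓐, #(vec e).support = if τ e then l else k) (hF : F ∈ 𝓐) (hτF : τ F = true) :
    ∃ E, IsCluster vec k l 𝓐 F E := by
  have : Nonempty ι := ⟨F⟩
  choose! E hE using h𝓐 F hF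
  refine ⟨E, hF, by rw [hcard F hF, if_pos hτF], fun u hu => (hE u hu).1, fun u hu => ?_,
    fun u hu => (hE u hu).2.2⟩
  obtain ⟨hmem, hτ, -⟩ := hE u hu
  rw [hcard _ hmem, if_neg (hτF ▸ hτ)]

theorem IsCrossing.hasClusters (h𝓐 : IsCrossing vec τ 𝓐)
    (hcard : ∀ e ∈ 𝓐, #(vec e).support = if τ e then l else k) (hkl : k ≠ l) :
    HasClusters vec k l 𝓐 := by
  intro B hB hBk w hw
  have hτB : τ B = false := by
    by_contra hτB
    rw [hcard B hB, if_pos (Bool.eq_true_of_not_eq_false hτB)] at hBk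
    exact hkl hBk.symm
  obtain ⟨F, hF, hτF, hBF⟩ := h𝓐 B hB w hw
  obtain ⟨E, hE⟩ := h𝓐.exists_isCluster hcard hF (by simpa [hτB] using hτF)
  exact ⟨F, E, hE, hBF⟩

theorem HasClusters.exists_isCluster (hcl : HasClusters vec k l 𝓐) (hk : 1 ≤ k)
    (hne : 𝓐.Nonempty) (h𝓐 : IsCrossing vec τ 𝓐)
    (hcard : ∀ e ∈ 𝓐, #(vec e).support = if τ e then l else k) :
    ∃ F E, IsCluster vec k l 𝓐 F E := by
  obtain ⟨e, he⟩ := hne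
  by_cases hτ : τ e = true
  · exact ⟨e, h𝓐.exists_isCluster hcard he hτ⟩
  · have hek : #(vec e).support = k := by rw [hcard e he, if_neg hτ]
    obtain ⟨v, hv⟩ : (vec e).support.Nonempty := Finset.card_pos.1 (by omega)
    obtain ⟨F, E, hE, -⟩ := hcl e he hek v hv
    exact ⟨F, E, hE⟩

theorem IsCluster.isClusterChain (hE : IsCluster vec k l 𝓐 F E) (hk : 3 ≤ k) (hkl : k < l)
    (hW : l ≤ W) (hsparse : IsSparse vec k l (l + 1) 𝓐 []) :
    ∃ c, c.length = l ∧ IsClusterChain vec k l W 𝓐 c [F] := by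
  have hfree := hE.isFree_nil hk hkl
    (IsSparse.addCluster (D := 0) (by simpa using hsparse) hE).weight_nonneg
  have hN : #(newVerts vec [] F) = l := by
    simpa [verts] using hE.card_newVerts_add (Γ := [])
  exact ⟨(newVerts vec [] F).toList.map E, by simpa using hN,
    ⟨hE.forall_mem_addCluster (by simp), by simp, hfree.isLocalChain hE (by omega)⟩,
    hfree.weight_addCluster_nil hE (by omega) (by omega),
    hfree.hasBranches hE hk (by omega) (by omega)⟩

theorem IsClusterChain.exists_extension (hc : IsClusterChain vec k l W 𝓐 c h)
    (hcl : HasClusters vec k l 𝓐) (hk : 3 ≤ k) (hkl : k < l) (hW : l ≤ W)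
    (hsparse : IsSparse vec k l (2 * l + 2) 𝓐 (c ++ h)) :
    ∃ c', c'.length = c.length + l ∧ IsClusterChain vec k l W 𝓐 c' h := by
  obtain ⟨F, E, hE, ⟨w, hw, hinter⟩, hfree⟩ :=
    exists_free_cluster hcl hk hkl hc.mem hc.hasBranches hc.weight_eq.le hsparse
  have hN : #(newVerts vec (c ++ h) F) + 1 = l := by
    simpa [hinter] using hE.card_newVerts_add (Γ := c ++ h)
  have happend : (newVerts vec (c ++ h) F).toList.map E ++ F :: c ++ h =
      addCluster vec F E (c ++ h) := by
    simp [addCluster]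
  refine ⟨(newVerts vec (c ++ h) F).toList.map E ++ F :: c, ?_, ⟨?_, hc.length_head_le, ?_⟩,
    ?_, ?_⟩
  · rw [List.length_append, List.length_map, Finset.length_toList, List.length_cons]
    omega
  · rw [happend]
    exact hE.forall_mem_addCluster hc.mem
  · exact IsLocalChain.append (c := F :: c) ⟨⟨w, hw, hinter⟩, hc.isLocalChain⟩
      (hfree.isLocalChain hE (by omega))
  · rw [happend, hfree.weight_addCluster_eq hE (by omega) (by omega) hinter, hc.weight_eq]
  · rw [happend]
    exact hfree.hasBranches hE hk (by omega) (by omega)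

theorem hasLongChain_of_card_eq_ite (h𝓐 : IsCrossing vec τ 𝓐) (hne : 𝓐.Nonempty)
    (hcard : ∀ e ∈ 𝓐, #(vec e).support = if τ e then l else k) (hk : 3 ≤ k) (hkl : k < l)
    (hW : l ≤ W) (hdense : ¬ HasDenseConfig vec k l W (2 * l + 2) L 𝓐) :
    HasLongChain vec k l W L 𝓐 := by
  have hcl := h𝓐.hasClusters hcard hkl.ne
  obtain ⟨F, E, hE⟩ := hcl.exists_isCluster (by omega) hne h𝓐 hcard
  have hnil : IsSparse vec k l (2 * l + 2) 𝓐 [] :=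
    isSparse_of_not_hasDenseConfig (c := []) (h := []) hdense ⟨by simp, by simp, trivial⟩
      (Nat.zero_le L)
  have hchain : ∀ m ≤ L / l, ∃ c, c.length = l * (m + 1) ∧ IsClusterChain vec k l W 𝓐 c [F] := by
    intro m
    induction m with
    | zero =>
      intro _
      simpa using hE.isClusterChain hk hkl hW (hnil.anti (by omega) subset_rfl)
    | succ m ih =>
      intro hm
      obtain ⟨c, hlength, hc⟩ := ih (by omega)
      have hcL : c.length ≤ L := by
        rw [hlength, mul_comm]
        exact (Nat.le_div_iff_mul_le (by omega)).1 hm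
      obtain ⟨c', hlength', hc'⟩ := hc.exists_extension hcl hk hkl hW
        (isSparse_of_not_hasDenseConfig (c := c) hdense hc.toIsExploration hcL)
      exact ⟨c', by rw [hlength', hlength]; ring, hc'⟩
  obtain ⟨c, hlength, hc⟩ := hchain _ le_rfl
  have hlt := Nat.lt_mul_div_succ L (by omega : 0 < l)
  have hle := Nat.mul_div_le L l
  exact ⟨c, [F], hc.toIsExploration, by omega, by rw [hlength, mul_add]; omega, hc.weight_eq.le⟩

theorem hasDenseConfig_or_hasLongChain (h𝓐 : Unavoidable vec τ 𝓐)
    (hcard : ∀ e ∈ 𝓐, #(vec e).support = if τ e then l else k) (hk : 3 ≤ k) (hkl : k ≤ l) :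
    HasDenseConfig vec k l l (2 * l + 2) L 𝓐 ∨ HasLongChain vec k l l L 𝓐 := by
  obtain ⟨𝓑, hsub, h𝓑⟩ := exists_minimal_le_of_wellFoundedLT (Unavoidable vec τ) 𝓐 h𝓐
  have hcard : ∀ e ∈ 𝓑, #(vec e).support = if τ e then l else k := fun e he => hcard e (hsub he)
  refine or_iff_not_imp_left.2 fun hdense => HasLongChain.mono ?_ hsub
  have hdense : ¬ HasDenseConfig vec k l l (2 * l + 2) L 𝓑 := fun h =>
    hdense (h.mono le_rfl le_rfl hsub)
  rcases hkl.lt_or_eq with hlt | rfl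
  · obtain ⟨e, he, -⟩ := h𝓑.prop fun _ => true
    exact hasLongChain_of_card_eq_ite (isCrossing_of_minimal h𝓑) ⟨e, he⟩ hcard hk hlt le_rfl hdense
  · exact hasLongChain_of_card_eq h𝓑 (by simpa using hcard) hk hk fun h =>
      hdense (h.mono (by omega) le_rfl subset_rfl)

end UnequalLengths

section Counting

variable {𝕜 V ι : Type*} [Field 𝕜] {vec : ι → V →₀ 𝕜} {Γ : List ι}

theorem exists_supported_le_sup (s : Finset V) {M : Submodule 𝕜 (V →₀ 𝕜)}
    (hM : M ≤ Finsupp.supported 𝕜 𝕜 (s : Set V)) :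
    ∃ I ⊆ s, #I + Module.finrank 𝕜 M = #s ∧
      Finsupp.supported 𝕜 𝕜 (s : Set V) ≤ M ⊔ Finsupp.supported 𝕜 𝕜 (I : Set V) := by
  have hfinrank : ∀ t : Finset V, FiniteDimensional 𝕜 (Finsupp.supported 𝕜 𝕜 (t : Set V)) ∧
      Module.finrank 𝕜 (Finsupp.supported 𝕜 𝕜 (t : Set V)) = #t := fun t =>
    ⟨.equiv (Finsupp.supportedEquivFinsupp (M := 𝕜) (R := 𝕜) (t : Set V)).symm, by
      rw [(Finsupp.supportedEquivFinsupp (M := 𝕜) (R := 𝕜) (t : Set V)).finrank_eq]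
      simp⟩
  let u : V → (V →₀ 𝕜) ⧸ M := fun v => M.mkQ (Finsupp.single v 1)
  have hu : Finsupp.linearCombination 𝕜 u = M.mkQ := by ext; simp [u]
  obtain ⟨I, hIs, -, hspan, hli⟩ :=
    exists_linearIndepOn_extension (linearIndepOn_empty 𝕜 u) (Set.empty_subset (s : Set V))
  lift I to Finset V using s.finite_toSet.subset hIs
  have hdisj : M ⊓ Finsupp.supported 𝕜 𝕜 (I : Set V) = ⊥ := by
    refine (Submodule.eq_bot_iff _).2 fun x ⟨hxM, hxI⟩ => linearIndepOn_iff.1 hli x hxI ?_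
    rwa [hu, Submodule.mkQ_apply, Submodule.Quotient.mk_eq_zero]
  have hle : Finsupp.supported 𝕜 𝕜 (s : Set V) ≤ M ⊔ Finsupp.supported 𝕜 𝕜 (I : Set V) := by
    rw [Finsupp.supported_eq_span_single, Submodule.span_le]
    rintro _ ⟨v, hv, rfl⟩
    have hmem : M.mkQ (Finsupp.single v 1) ∈ (Finsupp.supported 𝕜 𝕜 (I : Set V)).map M.mkQ := by
      rw [Finsupp.supported_eq_span_single, Submodule.map_span, ← Set.image_comp]
      exact hspan ⟨v, hv, rfl⟩
    rwa [← Submodule.mem_comap, Submodule.comap_map_mkQ] at hmem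
  have hsup : M ⊔ Finsupp.supported 𝕜 𝕜 (I : Set V) = Finsupp.supported 𝕜 𝕜 (s : Set V) :=
    (sup_le hM (Finsupp.supported_mono hIs)).antisymm hle
  have := (hfinrank s).1
  have := (hfinrank I).1
  have := Submodule.finiteDimensional_of_le hM
  have hdim := Submodule.finrank_sup_add_finrank_inf_eq M (Finsupp.supported 𝕜 𝕜 (I : Set V))
  rw [hdisj, hsup, finrank_bot, (hfinrank s).2, (hfinrank I).2] at hdim
  exact ⟨I, Finset.coe_subset.1 hIs, by omega, hle⟩

/-- The labelling `x` of the vertices by integers satisfies all the equations in `Γ`, the equation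
`e` having right-hand side `rhs e`. -/
def Solves (vec : ι → V →₀ 𝕜) (rhs : ι → 𝕜) (Γ : List ι) (x : V → ℤ) : Prop :=
  ∀ e ∈ Γ, Finsupp.linearCombination 𝕜 (fun v => (x v : 𝕜)) (vec e) = rhs e

variable {rhs : ι → 𝕜}

theorem Solves.eqOn [CharZero 𝕜] {x y : V → ℤ} {s I : Set V} (hx : Solves vec rhs Γ x)
    (hy : Solves vec rhs Γ y) (hxy : Set.EqOn x y I)
    (hs : Finsupp.supported 𝕜 𝕜 s ≤ relSpace vec Γ ⊔ Finsupp.supported 𝕜 𝕜 I) :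
    Set.EqOn x y s := by
  intro v hv
  have hle : relSpace vec Γ ⊔ Finsupp.supported 𝕜 𝕜 I ≤
      LinearMap.eqLocus (Finsupp.linearCombination 𝕜 fun v => (x v : 𝕜))
        (Finsupp.linearCombination 𝕜 fun v => (y v : 𝕜)) := by
    rw [Finsupp.supported_eq_span_single]
    refine sup_le (Submodule.span_le.2 ?_) (Submodule.span_le.2 ?_)
    · rintro _ ⟨e, he, rfl⟩
      exact (hx e he).trans (hy e he).symm
    · rintro _ ⟨w, hw, rfl⟩
      simp [hxy hw]
  simpa using hle (hs (Finsupp.single_mem_supported 𝕜 1 hv))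

variable [DecidableEq V]

theorem relSpace_le_supported_verts :
    relSpace vec Γ ≤ Finsupp.supported 𝕜 𝕜 (verts vec Γ : Set V) :=
  fun _ hx => Finset.coe_subset.2 (support_subset_verts_of_mem_relSpace hx)

theorem relRank_le_card_verts : relRank vec Γ ≤ #(verts vec Γ) := by
  obtain ⟨I, -, hcard, -⟩ := exists_supported_le_sup _ (relSpace_le_supported_verts (vec := vec))
  exact hcard ▸ Nat.le_add_left _ _

theorem exists_finset_image_verts_mem [CharZero 𝕜] (vec : ι → V →₀ 𝕜) (rhs : ι → 𝕜) (Γ : List ι)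
    (X : Finset ℤ) :
    ∃ T : Finset (Finset ℤ), #T ≤ #X ^ (#(verts vec Γ) - relRank vec Γ) ∧
      ∀ x, Solves vec rhs Γ x → (∀ v ∈ verts vec Γ, x v ∈ X) → (verts vec Γ).image x ∈ T := by
  obtain ⟨I, hI, hcard, hspan⟩ := exists_supported_le_sup (verts vec Γ) relSpace_le_supported_verts
  let restrict : (V → ℤ) → I → ℤ := fun x v => x v
  let extend : (I → ℤ) → V → ℤ := Function.invFunOn restrict {x | Solves vec rhs Γ x}
  refine ⟨(Fintype.piFinset fun _ : I => X).image fun g => (verts vec Γ).image (extend g), ?_,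
    fun x hx hxX => Finset.mem_image.2 ⟨restrict x,
      Fintype.mem_piFinset.2 fun v => hxX v (hI v.2), Finset.image_congr ?_⟩⟩
  · have hIcard : #I = #(verts vec Γ) - relRank vec Γ := by rw [← hcard, relRank]; omega
    rw [← hIcard]
    exact Finset.card_image_le.trans (by simp)
  · have hex : ∃ y ∈ {y | Solves vec rhs Γ y}, restrict y = restrict x := ⟨x, hx, rfl⟩
    exact (Function.invFunOn_mem hex).eqOn hx
      (fun v hv => congrFun (Function.invFunOn_eq hex) ⟨v, hv⟩) hspan

end Counting

section Probability

open MeasureTheory ProbabilityTheory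

variable {𝕜 V ι : Type*} [Field 𝕜] [DecidableEq V] {vec : ι → V →₀ 𝕜} {rhs : ι → 𝕜} {Γ : List ι}
  {n : ℕ} {p : unitInterval}

instance isProbabilityMeasure_randomSubset : IsProbabilityMeasure (randomSubset n p) := by
  unfold randomSubset
  infer_instance

theorem randomSubset_real_inter_subsets (s : Set (Set ℤ)) :
    (randomSubset n p).real {S ∈ s | S ⊆ Set.Icc 1 (n : ℤ)} = (randomSubset n p).real s := by
  rw [measureReal_def, measureReal_def, randomSubset,
    setBernoulli_apply_eq_apply_subsets (Set.Icc 1 (n : ℤ)) p s]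

theorem randomSubset_real_superset_le (t : Finset ℤ) :
    (randomSubset n p).real {S | ↑t ⊆ S} ≤ (p : ℝ) ^ #t := by
  have hpi : (fun q : ℤ → Prop => {i | q i}) ⁻¹' {S | ↑t ⊆ S} = Set.pi ↑t fun _ => {True} := by
    ext q
    simp [Set.subset_def]
  have hle : randomSubset n p {S | ↑t ⊆ S} ≤ (unitInterval.toNNReal p : ENNReal) ^ #t := by
    rw [randomSubset, setBernoulli_apply', hpi,
      Measure.infinitePi_pi _ fun _ _ => MeasurableSet.of_discrete]
    refine Finset.prod_le_pow_card _ _ _ fun i _ => ?_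
    by_cases hi : 1 ≤ i ∧ i ≤ n <;> simp [hi]
  refine (ENNReal.toReal_mono (by simp) hle).trans_eq ?_
  simp

/-- The set `S` contains a copy of `Γ`, with distinct integers in place of distinct vertices. -/
def IsRealized (vec : ι → V →₀ 𝕜) (rhs : ι → 𝕜) (Γ : List ι) (S : Set ℤ) : Prop :=
  ∃ x, Solves vec rhs Γ x ∧ Set.InjOn x (verts vec Γ) ∧ ∀ v ∈ verts vec Γ, x v ∈ S

theorem randomSubset_real_isRealized_le [CharZero 𝕜] :
    (randomSubset n p).real {S | IsRealized vec rhs Γ S} ≤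
      n ^ (#(verts vec Γ) - relRank vec Γ) * (p : ℝ) ^ #(verts vec Γ) := by
  obtain ⟨T, hT, hmem⟩ := exists_finset_image_verts_mem vec rhs Γ (Finset.Icc 1 (n : ℤ))
  have hcover : {S ∈ {S | IsRealized vec rhs Γ S} | S ⊆ Set.Icc 1 (n : ℤ)} ⊆
      ⋃ t ∈ T.filter (#· = #(verts vec Γ)), {S | ↑t ⊆ S} := by
    rintro S ⟨⟨x, hsol, hinj, hxS⟩, hS⟩
    refine Set.mem_biUnion (Finset.mem_filter.2 ⟨hmem x hsol fun v hv => ?_,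
      Finset.card_image_of_injOn hinj⟩) ?_
    · exact Finset.mem_Icc.2 (hS (hxS v hv))
    · simpa [Set.subset_def] using hxS
  rw [← randomSubset_real_inter_subsets]
  calc _ ≤ ∑ t ∈ T.filter (#· = #(verts vec Γ)), (randomSubset n p).real {S | ↑t ⊆ S} :=
        (measureReal_mono hcover (measure_ne_top _ _)).trans (measureReal_biUnion_finset_le _ _)
    _ ≤ ∑ _t ∈ T.filter (#· = #(verts vec Γ)), (p : ℝ) ^ #(verts vec Γ) :=
        Finset.sum_le_sum fun t ht => (Finset.mem_filter.1 ht).2 ▸ randomSubset_real_superset_le t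
    _ = #(T.filter (#· = #(verts vec Γ))) * (p : ℝ) ^ #(verts vec Γ) := by simp
    _ ≤ n ^ (#(verts vec Γ) - relRank vec Γ) * (p : ℝ) ^ #(verts vec Γ) := by
        have hle : #(T.filter (#· = #(verts vec Γ))) ≤ n ^ (#(verts vec Γ) - relRank vec Γ) :=
          (Finset.card_filter_le _ _).trans (by simpa using hT)
        exact mul_le_mul_of_nonneg_right (by exact_mod_cast hle) (pow_nonneg p.2.1 _)

theorem randomSubset_real_isRealized_le_rpow [CharZero 𝕜] {k l : ℕ} (hk : 1 ≤ k) (hl : 2 ≤ l)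
    {c : ℝ} (hn : 1 ≤ n) (hp : (p : ℝ) ≤ c * (n : ℝ) ^ (-(1 - (l : ℝ) / (k * (l - 1))))) :
    (randomSubset n p).real {S | IsRealized vec rhs Γ S} ≤
      c ^ #(verts vec Γ) * (n : ℝ) ^ (weight vec k l Γ / (k * (l - 1)) : ℝ) := by
  have hn0 : (0 : ℝ) < n := by exact_mod_cast hn
  have hk0 : (k : ℝ) ≠ 0 := by positivity
  have hl0 : (l : ℝ) - 1 ≠ 0 := by
    have : (2 : ℝ) ≤ l := by exact_mod_cast hl
    linarith
  calc (randomSubset n p).real {S | IsRealized vec rhs Γ S}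
      ≤ n ^ (#(verts vec Γ) - relRank vec Γ) * (p : ℝ) ^ #(verts vec Γ) :=
        randomSubset_real_isRealized_le
    _ ≤ n ^ (#(verts vec Γ) - relRank vec Γ) *
          (c * (n : ℝ) ^ (-(1 - (l : ℝ) / (k * (l - 1))))) ^ #(verts vec Γ) := by
        gcongr
        exact p.2.1
    _ = c ^ #(verts vec Γ) * (n : ℝ) ^ ((#(verts vec Γ) - relRank vec Γ : ℕ) +
          -(1 - (l : ℝ) / (k * (l - 1))) * #(verts vec Γ)) := by
        rw [Real.rpow_add hn0, Real.rpow_natCast, Real.rpow_mul_natCast hn0.le]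
        ring
    _ = c ^ #(verts vec Γ) * (n : ℝ) ^ (weight vec k l Γ / (k * (l - 1)) : ℝ) := by
        rw [Nat.cast_sub relRank_le_card_verts, weight]
        push_cast
        congr 2
        field_simp
        ring

end Probability

section Edges

variable {K : Bool → ℕ} {α β 𝕜 : Type*} [Field 𝕜] {a : (τ : Bool) → Fin (K τ) → 𝕜}

/-- A tuple of length `K false` or `K true`, together with its type. -/
abbrev Edge (K : Bool → ℕ) (α : Type*) := Σ τ : Bool, (Fin (K τ) → α)

/-- The image of an edge under a map of the vertices. -/
def Edge.map (f : α → β) (e : Edge K α) : Edge K β := ⟨e.1, f ∘ e.2⟩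

/-- The coefficient vector of the equation `∑ j, a e.1 j * x (e.2 j) = b` in the unknowns `x v`. -/
noncomputable def edgeVec (a : (τ : Bool) → Fin (K τ) → 𝕜) (e : Edge K α) : α →₀ 𝕜 :=
  ∑ j, Finsupp.single (e.2 j) (a e.1 j)

theorem edgeVec_map (f : α → β) (e : Edge K α) :
    edgeVec a (e.map f) = Finsupp.mapDomain f (edgeVec a e) := by
  simp only [edgeVec, Finsupp.mapDomain_finsetSum, Finsupp.mapDomain_single]
  rfl

theorem relRank_map_le (f : α → β) (κ : List (Edge K α)) :
    relRank (edgeVec a) (κ.map (Edge.map f)) ≤ relRank (edgeVec a) κ := by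
  have hmap : relSpace (edgeVec a) (κ.map (Edge.map f)) =
      (relSpace (edgeVec a) κ).map (Finsupp.lmapDomain 𝕜 𝕜 f) := by
    have hset : {e | e ∈ κ.map (Edge.map f)} = Edge.map f '' {e | e ∈ κ} := by
      ext
      simp only [Set.mem_ofPred_eq, List.mem_map, Set.mem_image]
    rw [relSpace, relSpace, Submodule.map_span, hset, Set.image_image, Set.image_image]
    simp only [edgeVec_map, Finsupp.lmapDomain_apply]
  rw [relRank, relRank, hmap]
  exact Submodule.finrank_map_le _ _

theorem support_edgeVec_subset [DecidableEq α] {e : Edge K α} :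
    (edgeVec a e).support ⊆ Finset.univ.image e.2 := by
  refine Finsupp.support_finsetSum.trans (Finset.biUnion_subset.2 fun j _ => ?_)
  exact Finsupp.support_single_subset.trans (by simp)

theorem support_edgeVec [DecidableEq α] (ha : ∀ τ j, a τ j ≠ 0) {e : Edge K α}
    (he : Function.Injective e.2) : (edgeVec a e).support = Finset.univ.image e.2 := by
  refine support_edgeVec_subset.antisymm fun v hv => ?_
  obtain ⟨j, -, rfl⟩ := Finset.mem_image.1 hv
  simpa [edgeVec, Finsupp.finsetSum_apply, Finsupp.single_apply, he.eq_iff] using ha e.1 j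

theorem card_support_edgeVec_le (e : Edge K α) : #(edgeVec a e).support ≤ K e.1 := by
  classical
  exact (Finset.card_le_card support_edgeVec_subset).trans (Finset.card_image_le.trans (by simp))

theorem card_support_edgeVec (ha : ∀ τ j, a τ j ≠ 0) {e : Edge K α}
    (he : Function.Injective e.2) : #(edgeVec a e).support = K e.1 := by
  classical
  rw [support_edgeVec ha he, Finset.card_image_of_injective _ he, Finset.card_fin]

variable [DecidableEq α] {e : Edge K α} {κ : List (Edge K α)}

theorem exists_apply_eq_of_mem_verts {v : α} (hv : v ∈ verts (edgeVec a) κ) :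
    ∃ e ∈ κ, ∃ j, e.2 j = v := by
  obtain ⟨e, he, hev⟩ := mem_verts.1 hv
  obtain ⟨j, -, hj⟩ := Finset.mem_image.1 (support_edgeVec_subset hev)
  exact ⟨e, he, j, hj⟩

theorem card_verts_edgeVec_le {l : ℕ} (hK : ∀ τ, K τ ≤ l) :
    #(verts (edgeVec a) κ) ≤ κ.length * l := by
  induction κ with
  | nil => simp [verts]
  | cons e κ ih =>
    rw [List.length_cons, add_mul, one_mul, add_comm]
    exact (Finset.card_union_le _ _).trans
      (add_le_add ((card_support_edgeVec_le e).trans (hK e.1)) ih)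

theorem verts_map [DecidableEq β] {f : α → β} (hf : Set.InjOn f (verts (edgeVec a) κ)) :
    verts (edgeVec a) (κ.map (Edge.map f)) = (verts (edgeVec a) κ).image f := by
  induction κ with
  | nil => simp [verts]
  | cons e κ ih =>
    rw [verts, Finset.coe_union] at hf
    rw [List.map_cons, verts, verts, ih (hf.mono Set.subset_union_right), Finset.image_union,
      edgeVec_map, Finsupp.mapDomain_support_of_injOn _ (hf.mono Set.subset_union_left)]

end Edges

section Codes

variable {K : Bool → ℕ} {𝕜 : Type*} [Field 𝕜] {a : (τ : Bool) → Fin (K τ) → 𝕜} {l W m : ℕ}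
  {C : Finset (List (Edge K ℕ))}

/-- The edges with all labels below `m`. -/
def freeEdges (K : Bool → ℕ) (m : ℕ) : Finset (Edge K ℕ) :=
  Finset.univ.sigma fun _ => Fintype.piFinset fun _ => Finset.range m

/-- The edges with one label from the first `W` edges of `κ`, all other labels being fresh. -/
noncomputable def attachedEdges (a : (τ : Bool) → Fin (K τ) → 𝕜) (l W : ℕ)
    (κ : List (Edge K ℕ)) : Finset (Edge K ℕ) :=
  ((Finset.univ : Finset (Σ τ : Bool, Fin (K τ))) ×ˢ verts (edgeVec a) (κ.take W)).image fun x =>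
    ⟨x.1.1, fun q => if q = x.1.2 then x.2 else l * κ.length + q⟩

/-- Prolong each code by at most one arbitrary edge. -/
def freeStep (l : ℕ) (C : Finset (List (Edge K ℕ))) : Finset (List (Edge K ℕ)) :=
  C ∪ C.biUnion fun κ => (freeEdges K (l * (κ.length + 1))).image (· :: κ)

/-- Prolong each code by one edge, attached to its first `W` edges. -/
noncomputable def attachStep (a : (τ : Bool) → Fin (K τ) → 𝕜) (l W : ℕ)
    (C : Finset (List (Edge K ℕ))) : Finset (List (Edge K ℕ)) :=
  C.biUnion fun κ => (attachedEdges a l W κ).image (· :: κ)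

/-- A family of codes that represents, up to relabelling, every exploration of length `j` prolonged
by at most `D` further edges. The `i`-th edge of a code uses labels below `l * i`. -/
noncomputable def chainCodes (a : (τ : Bool) → Fin (K τ) → 𝕜) (l W D j : ℕ) :
    Finset (List (Edge K ℕ)) :=
  (freeStep l)^[D] ((attachStep a l W)^[j] ((freeStep l)^[3] {[]}))

theorem card_freeEdges_le (hK : ∀ τ, K τ ≤ l) (hm : 1 ≤ m) : #(freeEdges K m) ≤ 2 * m ^ l := by
  simp only [freeEdges, Finset.card_sigma, Fintype.card_piFinset, Finset.card_range,
    Finset.prod_const, Finset.card_univ, Fintype.card_fin]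
  calc ∑ τ : Bool, m ^ K τ ≤ ∑ _τ : Bool, m ^ l :=
        Finset.sum_le_sum fun τ _ => Nat.pow_le_pow_right hm (hK τ)
    _ = 2 * m ^ l := by simp

theorem card_attachedEdges_le (hK : ∀ τ, K τ ≤ l) (κ : List (Edge K ℕ)) :
    #(attachedEdges a l W κ) ≤ 2 * l * (W * l) := by
  have hverts : #(verts (edgeVec a) (κ.take W)) ≤ W * l :=
    (card_verts_edgeVec_le hK).trans (Nat.mul_le_mul_right l (List.length_take_le W κ))
  have hpos : Fintype.card (Σ τ : Bool, Fin (K τ)) ≤ 2 * l := by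
    simpa [two_mul] using add_le_add (hK true) (hK false)
  refine Finset.card_image_le.trans ?_
  rw [Finset.card_product, Finset.card_univ]
  exact Nat.mul_le_mul hpos hverts

theorem card_attachStep_le (hK : ∀ τ, K τ ≤ l) :
    #(attachStep a l W C) ≤ #C * (2 * l * (W * l)) :=
  Finset.card_biUnion_le_card_mul _ _ _ fun κ _ =>
    Finset.card_image_le.trans (card_attachedEdges_le hK κ)

theorem card_freeStep_le (hK : ∀ τ, K τ ≤ l) (hl : 1 ≤ l) (hm : ∀ κ ∈ C, κ.length ≤ m) :
    #(freeStep l C) ≤ #C * (1 + 2 * (l * (m + 1)) ^ l) := by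
  rw [mul_add, mul_one]
  refine (Finset.card_union_le _ _).trans (Nat.add_le_add_left ?_ _)
  refine Finset.card_biUnion_le_card_mul _ _ _ fun κ hκ => Finset.card_image_le.trans ?_
  calc #(freeEdges K (l * (κ.length + 1))) ≤ 2 * (l * (κ.length + 1)) ^ l :=
        card_freeEdges_le hK (Nat.mul_pos hl κ.length.succ_pos)
    _ ≤ 2 * (l * (m + 1)) ^ l := by gcongr; exact hm κ hκ

theorem length_le_of_mem_attachStep (hm : ∀ κ ∈ C, κ.length ≤ m) :
    ∀ κ ∈ attachStep a l W C, κ.length ≤ m + 1 := by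
  intro κ hκ
  simp only [attachStep, Finset.mem_biUnion, Finset.mem_image] at hκ
  obtain ⟨κ, hκ, e, -, rfl⟩ := hκ
  simpa using hm κ hκ

theorem length_le_of_mem_freeStep (hm : ∀ κ ∈ C, κ.length ≤ m) :
    ∀ κ ∈ freeStep l C, κ.length ≤ m + 1 := by
  intro κ hκ
  simp only [freeStep, Finset.mem_union, Finset.mem_biUnion, Finset.mem_image] at hκ
  obtain hκ | ⟨κ, hκ, e, -, rfl⟩ := hκ
  · exact (hm κ hκ).trans m.le_succ
  · simpa using hm κ hκ

theorem length_le_of_mem_iterate_freeStep (hm : ∀ κ ∈ C, κ.length ≤ m) (D : ℕ) :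
    ∀ κ ∈ (freeStep l)^[D] C, κ.length ≤ m + D := by
  induction D with
  | zero => exact hm
  | succ D ih =>
    rw [Function.iterate_succ_apply']
    exact length_le_of_mem_freeStep ih

theorem length_le_of_mem_iterate_attachStep (hm : ∀ κ ∈ C, κ.length ≤ m) (j : ℕ) :
    ∀ κ ∈ (attachStep a l W)^[j] C, κ.length ≤ m + j := by
  induction j with
  | zero => exact hm
  | succ j ih =>
    rw [Function.iterate_succ_apply']
    exact length_le_of_mem_attachStep ih

theorem card_iterate_freeStep_le (hK : ∀ τ, K τ ≤ l) (hl : 1 ≤ l) (hm : ∀ κ ∈ C, κ.length ≤ m)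
    (D : ℕ) : #((freeStep l)^[D] C) ≤ #C * (1 + 2 * (l * (m + D + 1)) ^ l) ^ D := by
  induction D with
  | zero => simp
  | succ D ih =>
    rw [Function.iterate_succ_apply']
    calc _ ≤ #((freeStep l)^[D] C) * (1 + 2 * (l * (m + D + 1)) ^ l) :=
          card_freeStep_le hK hl (length_le_of_mem_iterate_freeStep hm D)
      _ ≤ #C * (1 + 2 * (l * (m + D + 1)) ^ l) ^ D * (1 + 2 * (l * (m + D + 1)) ^ l) :=
          Nat.mul_le_mul_right _ ih
      _ = #C * (1 + 2 * (l * (m + D + 1)) ^ l) ^ (D + 1) := by ring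
      _ ≤ #C * (1 + 2 * (l * (m + (D + 1) + 1)) ^ l) ^ (D + 1) := by gcongr; omega

theorem card_iterate_attachStep_le (hK : ∀ τ, K τ ≤ l) (j : ℕ) :
    #((attachStep a l W)^[j] C) ≤ #C * (2 * l * (W * l)) ^ j := by
  induction j with
  | zero => simp
  | succ j ih =>
    rw [Function.iterate_succ_apply', pow_succ, ← mul_assoc]
    exact (card_attachStep_le hK).trans (Nat.mul_le_mul_right _ ih)

theorem exists_card_chainCodes_le (a : (τ : Bool) → Fin (K τ) → 𝕜) (W : ℕ) (hK : ∀ τ, K τ ≤ l)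
    (hl : 1 ≤ l) : ∃ H : ℕ, ∀ D j, #(chainCodes a l W D j) ≤
      H * (2 * l * (W * l)) ^ j * (1 + 2 * (l * (3 + j + D + 1)) ^ l) ^ D := by
  refine ⟨#((freeStep l)^[3] {([] : List (Edge K ℕ))}), fun D j => ?_⟩
  have hhead : ∀ κ ∈ (freeStep l)^[3] {([] : List (Edge K ℕ))}, κ.length ≤ 3 := fun κ hκ => by
    simpa using length_le_of_mem_iterate_freeStep (m := 0) (by simp) 3 κ hκ
  exact (card_iterate_freeStep_le hK hl (length_le_of_mem_iterate_attachStep hhead j) D).trans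
    (Nat.mul_le_mul_right _ (card_iterate_attachStep_le hK j))

end Codes

section Coding

variable {K : Bool → ℕ} {α 𝕜 : Type*} [Field 𝕜] {a : (τ : Bool) → Fin (K τ) → 𝕜} {k l W D : ℕ}
  {κ : List (Edge K ℕ)} {x : ℕ → α} {C : Finset (List (Edge K ℕ))} {Γ : List (Edge K α)}
  {e : Edge K α}

/-- The code `κ` turns into `Γ` when its labels `v` are replaced by the vertices `x v`, and its
labels are small enough for the labels `l * κ.length + j` to be fresh. -/
structure IsCoding (a : (τ : Bool) → Fin (K τ) → 𝕜) (l : ℕ) (κ : List (Edge K ℕ)) (x : ℕ → α)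
    (Γ : List (Edge K α)) : Prop where
  map_eq : κ.map (Edge.map x) = Γ
  injOn : Set.InjOn x (verts (edgeVec a) κ)
  lt : ∀ e ∈ κ, ∀ j, e.2 j < l * κ.length

theorem IsCoding.lt_of_mem_verts (h : IsCoding a l κ x Γ) {v : ℕ}
    (hv : v ∈ verts (edgeVec a) κ) : v < l * κ.length := by
  obtain ⟨e, he, j, rfl⟩ := exists_apply_eq_of_mem_verts hv
  exact h.lt e he j

/-- Some code in `C` turns into `Γ` when its labels are replaced by vertices. -/
def IsCoded (a : (τ : Bool) → Fin (K τ) → 𝕜) (l : ℕ) (C : Finset (List (Edge K ℕ)))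
    (Γ : List (Edge K α)) : Prop :=
  ∃ κ ∈ C, ∃ x, IsCoding a l κ x Γ

theorem isCoded_nil [Nonempty α] : IsCoded a l {[]} ([] : List (Edge K α)) :=
  ⟨[], by simp, fun _ => Classical.arbitrary α, rfl, by simp [verts], by simp⟩

section DecidableEq

variable [DecidableEq α]

theorem IsCoding.image_verts (h : IsCoding a l κ x Γ) :
    (verts (edgeVec a) κ).image x = verts (edgeVec a) Γ := by
  rw [← h.map_eq, verts_map h.injOn]

theorem IsCoding.card_verts (h : IsCoding a l κ x Γ) :
    #(verts (edgeVec a) κ) = #(verts (edgeVec a) Γ) := by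
  rw [← h.image_verts, Finset.card_image_of_injOn h.injOn]

theorem IsCoding.weight_le (h : IsCoding a l κ x Γ) (hl : 1 ≤ l) :
    weight (edgeVec a) k l κ ≤ weight (edgeVec a) k l Γ := by
  have hrank : (relRank (edgeVec a) Γ : ℤ) ≤ relRank (edgeVec a) κ := by
    exact_mod_cast h.map_eq ▸ relRank_map_le x κ
  have hcoeff : (0 : ℤ) ≤ k * (l - 1) := mul_nonneg (by positivity) (by omega)
  rw [weight, weight, h.card_verts]
  linarith [mul_le_mul_of_nonneg_left hrank hcoeff]

theorem IsCoding.cons (h : IsCoding a l κ x Γ) (he : Function.Injective e.2)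
    {y : Fin (K e.1) → ℕ} {x' : ℕ → α} (hx' : ∀ v < l * κ.length, x' v = x v)
    (hx'y : ∀ j, x' (y j) = e.2 j) (hlt : ∀ j, y j < l * (κ.length + 1))
    (hold : ∀ j, e.2 j ∈ verts (edgeVec a) Γ → y j ∈ verts (edgeVec a) κ) :
    IsCoding a l (⟨e.1, y⟩ :: κ) x' (e :: Γ) := by
  have hx'κ : ∀ v ∈ verts (edgeVec a) κ, x' v = x v := fun v hv => hx' v (h.lt_of_mem_verts hv)
  have hmem : ∀ v ∈ verts (edgeVec a) κ, x' v ∈ verts (edgeVec a) Γ := fun v hv => by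
    rw [hx'κ v hv, ← h.image_verts]
    exact Finset.mem_image_of_mem x hv
  have hcases : ∀ v ∈ verts (edgeVec a) (⟨e.1, y⟩ :: κ),
      v ∈ verts (edgeVec a) κ ∨ ∃ j, y j = v ∧ e.2 j ∉ verts (edgeVec a) Γ := fun v hv => by
    obtain hv | hv := Finset.mem_union.1 hv
    · obtain ⟨j, -, rfl⟩ := Finset.mem_image.1 (support_edgeVec_subset hv)
      exact or_iff_not_imp_right.2 fun hj => hold j (by_contra fun hn => hj ⟨j, rfl, hn⟩)
    · exact Or.inl hv
  refine ⟨?_, fun v hv w hw hvw => ?_, ?_⟩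
  · rw [List.map_cons, ← h.map_eq]
    congr 1
    · exact Sigma.ext rfl (heq_of_eq (funext hx'y))
    · exact List.map_congr_left fun e he =>
        Sigma.ext rfl (heq_of_eq (funext fun j => hx' _ (h.lt e he j)))
  · obtain hv | ⟨i, rfl, hi⟩ := hcases v hv <;> obtain hw | ⟨j, rfl, hj⟩ := hcases w hw
    · exact h.injOn hv hw (by rwa [hx'κ v hv, hx'κ w hw] at hvw)
    · exact absurd (hx'y j ▸ hvw ▸ hmem v hv) hj
    · exact absurd (hx'y i ▸ hvw ▸ hmem w hw) hi
    · rw [he ((hx'y i).symm.trans (hvw.trans (hx'y j)))]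
  · refine List.forall_mem_cons.2 ⟨hlt, fun e he j => (h.lt e he j).trans_le ?_⟩
    exact Nat.mul_le_mul_left l κ.length.le_succ

theorem IsCoding.exists_cons (h : IsCoding a l κ x Γ) (hK : K e.1 ≤ l)
    (he : Function.Injective e.2) : ∃ (y : Fin (K e.1) → ℕ) (x' : ℕ → α),
      IsCoding a l (⟨e.1, y⟩ :: κ) x' (e :: Γ) ∧ ∀ j, x' (y j) = e.2 j ∧
        (e.2 j ∈ verts (edgeVec a) Γ → y j ∈ verts (edgeVec a) κ) ∧
        (e.2 j ∉ verts (edgeVec a) Γ → y j = l * κ.length + j) := by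
  have hlabel : ∀ j, ∃ u, (e.2 j ∈ verts (edgeVec a) Γ → u ∈ verts (edgeVec a) κ ∧ x u = e.2 j) ∧
      (e.2 j ∉ verts (edgeVec a) Γ → u = l * κ.length + j) := by
    intro j
    by_cases hj : e.2 j ∈ verts (edgeVec a) Γ
    · obtain ⟨u, hu, hxu⟩ := Finset.mem_image.1 (h.image_verts ▸ hj)
      exact ⟨u, fun _ => ⟨hu, hxu⟩, fun hj' => absurd hj hj'⟩
    · exact ⟨l * κ.length + j, fun hj' => absurd hj' hj, fun _ => rfl⟩
  choose y hold hnew using hlabel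
  let x' : ℕ → α := fun v => if hv : l * κ.length ≤ v ∧ v - l * κ.length < K e.1 then
    e.2 ⟨v - l * κ.length, hv.2⟩ else x v
  have hx' : ∀ v < l * κ.length, x' v = x v := fun v hv => dif_neg (by omega)
  have hy : ∀ j, x' (y j) = e.2 j ∧ y j < l * (κ.length + 1) := fun j => by
    rw [mul_add, mul_one]
    by_cases hj : e.2 j ∈ verts (edgeVec a) Γ
    · obtain ⟨hmem, hxy⟩ := hold j hj
      have hlt := h.lt_of_mem_verts hmem
      exact ⟨(hx' _ hlt).trans hxy, by omega⟩
    · rw [hnew j hj]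
      exact ⟨by simp [x'], by omega⟩
  exact ⟨y, x', h.cons he hx' (fun j => (hy j).1) (fun j => (hy j).2) fun j hj => (hold j hj).1,
    fun j => ⟨(hy j).1, fun hj => (hold j hj).1, hnew j⟩⟩

theorem IsCoded.cons_attachStep (h : IsCoded a l C Γ) (ha : ∀ τ j, a τ j ≠ 0) (hK : K e.1 ≤ l)
    (he : Function.Injective e.2) (hatt : Attaches (edgeVec a) W e Γ) :
    IsCoded a l (attachStep a l W C) (e :: Γ) := by
  obtain ⟨κ, hκ, x, hcoding⟩ := h
  obtain ⟨y, x', hcoding', hy⟩ := hcoding.exists_cons hK he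
  obtain ⟨v, hvW, hinter⟩ := hatt
  obtain ⟨hve, hvΓ, huniq⟩ := inter_eq_singleton_iff.1 hinter
  rw [support_edgeVec ha he] at hve huniq
  obtain ⟨i, -, rfl⟩ := Finset.mem_image.1 hve
  have hnew : ∀ q, q ≠ i → y q = l * κ.length + q := fun q hq =>
    (hy q).2.2 fun hqΓ => hq (he (huniq _ (Finset.mem_image_of_mem _ (Finset.mem_univ q)) hqΓ))
  have hsub : verts (edgeVec a) (κ.take W) ⊆ verts (edgeVec a) (⟨e.1, y⟩ :: κ) :=
    verts_mono fun _ hg => List.mem_cons_of_mem _ (List.mem_of_mem_take hg)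
  have hyi : y i ∈ verts (edgeVec a) (κ.take W) := by
    rw [← (List.cons.inj hcoding'.map_eq).2, ← List.map_take,
      verts_map (hcoding'.injOn.mono hsub)] at hvW
    obtain ⟨u, hu, hxu⟩ := Finset.mem_image.1 hvW
    have hyκ : y i ∈ verts (edgeVec a) (⟨e.1, y⟩ :: κ) :=
      Finset.mem_union_right _ ((hy i).2.1 hvΓ)
    rwa [← hcoding'.injOn (hsub hu) hyκ (hxu.trans (hy i).1.symm)]
  refine ⟨⟨e.1, y⟩ :: κ, ?_, x', hcoding'⟩
  simp only [attachStep, attachedEdges, Finset.mem_biUnion, Finset.mem_image, Finset.mem_product]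
  refine ⟨κ, hκ, ⟨e.1, y⟩, ⟨(⟨e.1, i⟩, y i), ⟨Finset.mem_univ _, hyi⟩, ?_⟩, rfl⟩
  refine Sigma.ext rfl (heq_of_eq (funext fun q => ?_))
  by_cases hq : q = i
  · simp [hq]
  · simp [hq, hnew q hq]

end DecidableEq

theorem IsCoded.cons_freeStep (h : IsCoded a l C Γ) (hK : K e.1 ≤ l)
    (he : Function.Injective e.2) : IsCoded a l (freeStep l C) (e :: Γ) := by
  classical
  obtain ⟨κ, hκ, x, hcoding⟩ := h
  obtain ⟨y, x', hcoding', -⟩ := hcoding.exists_cons hK he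
  refine ⟨⟨e.1, y⟩ :: κ, ?_, x', hcoding'⟩
  simp only [freeStep, freeEdges, Finset.mem_union, Finset.mem_biUnion, Finset.mem_image]
  refine Or.inr ⟨κ, hκ, ⟨e.1, y⟩, ?_, rfl⟩
  simpa using hcoding'.lt _ List.mem_cons_self

theorem IsCoded.append_iterate_freeStep (h : IsCoded a l C Γ) (hK : ∀ τ, K τ ≤ l)
    {t : List (Edge K α)} (ht : ∀ e ∈ t, Function.Injective e.2) (hD : t.length ≤ D) :
    IsCoded a l ((freeStep l)^[D] C) (t ++ Γ) := by
  induction D generalizing t with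
  | zero => simpa [List.length_eq_zero_iff.1 (Nat.le_zero.1 hD)] using h
  | succ D ih =>
    rw [Function.iterate_succ_apply']
    cases t with
    | nil =>
      obtain ⟨κ, hκ, hcoding⟩ := ih (t := []) (by simp) (by simp)
      exact ⟨κ, Finset.mem_union_left _ hκ, hcoding⟩
    | cons e t =>
      obtain ⟨he, ht⟩ := List.forall_mem_cons.1 ht
      exact (ih ht (by simpa using hD)).cons_freeStep (hK e.1) he

theorem IsExploration.isCoded [DecidableEq α] [Nonempty α] {𝓐 : Finset (Edge K α)}
    {c h t : List (Edge K α)} (hc : IsExploration (edgeVec a) W 𝓐 c h) (ha : ∀ τ j, a τ j ≠ 0)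
    (hK : ∀ τ, K τ ≤ l) (hinj : ∀ e ∈ 𝓐, Function.Injective e.2) (ht : ∀ e ∈ t, e ∈ 𝓐)
    (hD : t.length ≤ D) : IsCoded a l (chainCodes a l W D c.length) (t ++ (c ++ h)) := by
  have hchain : IsCoded a l ((attachStep a l W)^[c.length] ((freeStep l)^[3] {[]})) (c ++ h) := by
    obtain ⟨hmem, hhead, hlocal⟩ := hc
    induction c with
    | nil =>
      simpa using isCoded_nil.append_iterate_freeStep hK (fun e he => hinj e (hmem e he)) hhead
    | cons e c ih =>
      obtain ⟨hatt, hlocal⟩ := hlocal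
      rw [List.cons_append, List.forall_mem_cons] at hmem
      rw [List.length_cons, Function.iterate_succ_apply']
      exact (ih hmem.2 hlocal).cons_attachStep ha (hK e.1) (hinj e hmem.1) hatt
  exact hchain.append_iterate_freeStep hK (fun e he => hinj e (ht e he)) hD

end Coding

section Configurations

variable {K : Bool → ℕ} {𝕜 : Type*} [Field 𝕜] {a : (τ : Bool) → Fin (K τ) → 𝕜} {b : Bool → 𝕜}
  {k l D j : ℕ} {w : ℤ} {κ : List (Edge K ℕ)} {x : ℕ → ℤ} {Γ : List (Edge K ℤ)} {S : Set ℤ}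

/-- The solutions in distinct elements of `S` of the two equations with coefficients `a τ` and
right-hand side `b τ`. -/
def solutions (a : (τ : Bool) → Fin (K τ) → 𝕜) (b : Bool → 𝕜) (S : Set ℤ) : Set (Edge K ℤ) :=
  {e | Function.Injective e.2 ∧ (∀ j, e.2 j ∈ S) ∧ ∑ j, a e.1 j * e.2 j = b e.1}

theorem finite_solutions (hS : S.Finite) : (solutions a b S).Finite := by
  refine (Finset.univ.sigma fun τ : Bool =>
    Fintype.piFinset fun _ : Fin (K τ) => hS.toFinset).finite_toSet.subset fun e he => ?_
  simpa using he.2.1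

theorem IsCoding.isRealized (h : IsCoding a l κ x Γ) (hΓ : ∀ e ∈ Γ, e ∈ solutions a b S) :
    IsRealized (edgeVec a) (fun e => b e.1) κ S := by
  have hsol : ∀ e ∈ κ, e.map x ∈ solutions a b S := fun e he =>
    hΓ _ (h.map_eq ▸ List.mem_map_of_mem he)
  refine ⟨x, fun e he => ?_, h.injOn, fun v hv => ?_⟩
  · refine Eq.trans ?_ (hsol e he).2.2
    simp only [edgeVec, map_sum, Finsupp.linearCombination_single, smul_eq_mul]
    rfl
  · obtain ⟨e, he, j, rfl⟩ := exists_apply_eq_of_mem_verts hv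
    exact (hsol e he).2.1 j

/-- The set `S` contains a copy of an exploration of length `j` prolonged by at most `D` edges,
where the resulting configuration has weight at most `w`. -/
def HasConfig (a : (τ : Bool) → Fin (K τ) → 𝕜) (b : Bool → 𝕜) (k l D j : ℕ) (w : ℤ)
    (S : Set ℤ) : Prop :=
  ∃ κ ∈ chainCodes a l l D j, j ≤ #(verts (edgeVec a) κ) ∧ weight (edgeVec a) k l κ ≤ w ∧
    IsRealized (edgeVec a) (fun e => b e.1) κ S

theorem IsExploration.hasConfig {𝓐 : Finset (Edge K ℤ)} {c h t : List (Edge K ℤ)}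
    (hc : IsExploration (edgeVec a) l 𝓐 c h) (ha : ∀ τ j, a τ j ≠ 0) (hK : ∀ τ, K τ ≤ l)
    (htwo : ∀ τ, 2 ≤ K τ) (h𝓐 : ∀ e ∈ 𝓐, e ∈ solutions a b S) (ht : ∀ e ∈ t, e ∈ 𝓐)
    (hD : t.length ≤ D) (hw : weight (edgeVec a) k l (t ++ (c ++ h)) ≤ w) :
    HasConfig a b k l D c.length w S := by
  have hl : 1 ≤ l := one_le_two.trans ((htwo true).trans (hK true))
  obtain ⟨κ, hκ, x, hcoding⟩ := hc.isCoded ha hK (fun e he => (h𝓐 e he).1) ht hD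
  refine ⟨κ, hκ, ?_, (hcoding.weight_le hl).trans hw,
    hcoding.isRealized fun e he => h𝓐 e ?_⟩
  · have hlength := hc.isLocalChain.length_le_card_verts fun e he => by
      rw [card_support_edgeVec ha (h𝓐 e (hc.mem e (List.mem_append_left h he))).1]
      exact htwo e.1
    exact hcoding.card_verts ▸ hlength.trans
      (Finset.card_le_card (verts_mono (List.subset_append_right _ _)))
  · exact (List.mem_append.1 he).elim (ht e) (hc.mem e)

theorem exists_hasConfig (ha : ∀ τ j, a τ j ≠ 0) (hK : ∀ τ, K τ = if τ then l else k)
    (hk : 3 ≤ k) (hkl : k ≤ l) (hS : S.Finite)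
    (hsol : ∀ χ : ℤ → Bool, ∃ e ∈ solutions a b S, ∀ j, χ (e.2 j) = e.1) (L : ℕ) :
    (∃ j ≤ L, HasConfig a b k l (2 * l + 2) j (-1) S) ∨
      ∃ j ∈ Finset.Icc L (L + l), HasConfig a b k l 0 j k S := by
  have hKl : ∀ τ, K τ ≤ l := fun τ => by rw [hK]; split_ifs <;> omega
  have htwo : ∀ τ, 2 ≤ K τ := fun τ => by rw [hK]; split_ifs <;> omega
  have h𝓐 : ∀ e ∈ (finite_solutions (a := a) (b := b) hS).toFinset, e ∈ solutions a b S :=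
    fun e he => (Set.Finite.mem_toFinset _).1 he
  have hunavoidable : Unavoidable (edgeVec a) Sigma.fst
      (finite_solutions (a := a) (b := b) hS).toFinset := fun χ => by
    obtain ⟨e, he, hχ⟩ := hsol χ
    refine ⟨e, (Set.Finite.mem_toFinset _).2 he, fun v hv => ?_⟩
    obtain ⟨j, -, rfl⟩ := Finset.mem_image.1 (support_edgeVec_subset hv)
    exact hχ j
  obtain ⟨c, h, hc, hL, hsparse⟩ | ⟨c, h, hc, hL, hLl, hw⟩ :=
    hasDenseConfig_or_hasLongChain (L := L) hunavoidable
      (fun e he => (card_support_edgeVec ha (h𝓐 e he).1).trans (hK e.1)) hk hkl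
  · simp only [IsSparse, not_forall, not_le] at hsparse
    obtain ⟨t, hD, ht, hw⟩ := hsparse
    exact Or.inl ⟨c.length, hL, hc.hasConfig ha hKl htwo h𝓐 ht hD (by omega)⟩
  · exact Or.inr ⟨c.length, Finset.mem_Icc.2 ⟨hL, hLl⟩,
      hc.hasConfig (t := []) ha hKl htwo h𝓐 (by simp) le_rfl hw⟩

end Configurations

section FirstMoment

open MeasureTheory

variable {K : Bool → ℕ} {𝕜 : Type*} [Field 𝕜] [CharZero 𝕜] {a : (τ : Bool) → Fin (K τ) → 𝕜}
  {b : Bool → 𝕜} {k l D j n : ℕ} {w : ℤ} {c : ℝ} {p : unitInterval}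

theorem randomSubset_real_hasConfig_le (hk : 1 ≤ k) (hl : 2 ≤ l) (hc0 : 0 ≤ c) (hc1 : c ≤ 1)
    (hn : 1 ≤ n) (hp : (p : ℝ) ≤ c * (n : ℝ) ^ (-(1 - (l : ℝ) / (k * (l - 1))))) :
    (randomSubset n p).real {S | HasConfig a b k l D j w S} ≤
      #(chainCodes a l l D j) * (c ^ j * (n : ℝ) ^ (w / (k * (l - 1)) : ℝ)) := by
  let C := (chainCodes a l l D j).filter fun κ =>
    j ≤ #(verts (edgeVec a) κ) ∧ weight (edgeVec a) k l κ ≤ w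
  have hcover : {S | HasConfig a b k l D j w S} ⊆
      ⋃ κ ∈ C, {S | IsRealized (edgeVec a) (fun e => b e.1) κ S} := by
    rintro S ⟨κ, hκ, hj, hw, hreal⟩
    exact Set.mem_biUnion (Finset.mem_filter.2 ⟨hκ, hj, hw⟩) hreal
  have hcode : ∀ κ ∈ C, (randomSubset n p).real
      {S | IsRealized (edgeVec a) (fun e => b e.1) κ S} ≤
        c ^ j * (n : ℝ) ^ (w / (k * (l - 1)) : ℝ) := by
    intro κ hκ
    obtain ⟨-, hj, hw⟩ := Finset.mem_filter.1 hκ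
    have hl1 : (1 : ℝ) ≤ l := by exact_mod_cast one_le_two.trans hl
    have hdiv : (weight (edgeVec a) k l κ / (k * (l - 1)) : ℝ) ≤ w / (k * (l - 1)) :=
      div_le_div_of_nonneg_right (by exact_mod_cast hw)
        (mul_nonneg k.cast_nonneg (sub_nonneg.2 hl1))
    refine (randomSubset_real_isRealized_le_rpow hk hl hn hp).trans ?_
    exact mul_le_mul (pow_le_pow_of_le_one hc0 hc1 hj)
      (Real.rpow_le_rpow_of_exponent_le (by exact_mod_cast hn) hdiv) (by positivity)
      (by positivity)
  calc (randomSubset n p).real {S | HasConfig a b k l D j w S}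
      ≤ ∑ κ ∈ C, (randomSubset n p).real {S | IsRealized (edgeVec a) (fun e => b e.1) κ S} :=
        (measureReal_mono hcover (measure_ne_top _ _)).trans (measureReal_biUnion_finset_le _ _)
    _ ≤ ∑ _κ ∈ C, c ^ j * (n : ℝ) ^ (w / (k * (l - 1)) : ℝ) := Finset.sum_le_sum hcode
    _ ≤ #(chainCodes a l l D j) * (c ^ j * (n : ℝ) ^ (w / (k * (l - 1)) : ℝ)) := by
        rw [Finset.sum_const, nsmul_eq_mul]
        gcongr
        exact Finset.filter_subset _ _

variable (a b) in
/-- The constant is chosen such that `c ^ j` beats the number `(2 * l * (l * l)) ^ j` of ways to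
attach `j` edges by a factor `exp (-j)`. -/
theorem exists_randomSubset_real_hasConfig_le (hk : 1 ≤ k) (hl : 2 ≤ l) (hK : ∀ τ, K τ ≤ l) :
    ∃ H : ℕ, ∀ (D j : ℕ) (w : ℤ) (n : ℕ) (p : unitInterval), 1 ≤ n →
      (p : ℝ) ≤ Real.exp (-1) / (2 * l * (l * l)) * (n : ℝ) ^ (-(1 - (l : ℝ) / (k * (l - 1)))) →
      (randomSubset n p).real {S | HasConfig a b k l D j w S} ≤
        H * Real.exp (-j) * (1 + 2 * (l * (3 + j + D + 1)) ^ l) ^ D *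
          (n : ℝ) ^ (w / (k * (l - 1)) : ℝ) := by
  obtain ⟨H, hH⟩ := exists_card_chainCodes_le a l hK (by omega)
  refine ⟨H, fun D j w n p hn hp => ?_⟩
  have hN : 0 < 2 * l * (l * l) := by
    have : 0 < l := by omega
    positivity
  have hN1 : (1 : ℝ) ≤ 2 * l * (l * l) := by exact_mod_cast hN
  have hc1 : Real.exp (-1) / (2 * l * (l * l)) ≤ 1 :=
    (div_le_self (Real.exp_pos _).le hN1).trans (Real.exp_le_one_iff.2 (by norm_num))
  have hcard : (#(chainCodes a l l D j) : ℝ) ≤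
      H * (2 * l * (l * l)) ^ j * (1 + 2 * (l * (3 + j + D + 1)) ^ l) ^ D := by
    exact_mod_cast hH D j
  refine (randomSubset_real_hasConfig_le hk hl (by positivity) hc1 hn hp).trans
    ((mul_le_mul_of_nonneg_right hcard (by positivity)).trans_eq ?_)
  have hexp : Real.exp (-1) ^ j = Real.exp (-j) := by
    rw [← Real.exp_nat_mul, mul_neg_one]
  rw [div_pow, hexp]
  field_simp

end FirstMoment

section Thresholds

theorem rank_row_eq_one {𝕜 n : Type*} [Field 𝕜] [Fintype n] (M : Matrix (Fin 1) n 𝕜) {j : n}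
    (hj : M 0 j ≠ 0) : M.rank = 1 := by
  classical
  have hrank : M.rank ≠ 0 := fun h0 => by
    rw [Matrix.rank, Submodule.finrank_eq_zero, LinearMap.range_eq_bot] at h0
    have hcol := congrFun (LinearMap.congr_fun h0 (Pi.single j 1)) 0
    exact hj (by simpa using hcol)
  exact le_antisymm (by simpa using M.rank_le_card_height) (Nat.one_le_iff_ne_zero.2 hrank)

namespace LinearEquation

variable (A B : LinearEquation)

theorem rankQ_underlyingMatrix (hA : 0 < A.length) : rankQ A.underlyingMatrix = 1 :=
  rank_row_eq_one _ (j := ⟨0, hA⟩) (by simpa [underlyingMatrix] using A.coeff_ne_zero ⟨0, hA⟩)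

theorem rankCompl_univ : rankCompl A.underlyingMatrix Finset.univ = 0 := by
  have : IsEmpty {j : Fin A.length // j ∉ (Finset.univ : Finset (Fin A.length))} :=
    ⟨fun j => j.2 (Finset.mem_univ _)⟩
  exact Nat.le_zero.1 ((Matrix.rank_le_card_width _).trans_eq Fintype.card_eq_zero)

theorem rankCompl_of_ne_univ {W : Finset (Fin A.length)} (hW : W ≠ Finset.univ) :
    rankCompl A.underlyingMatrix W = 1 := by
  obtain ⟨j, hj⟩ : ∃ j, j ∉ W := by
    simpa [Finset.eq_univ_iff_forall] using hW
  exact rank_row_eq_one _ (j := ⟨j, hj⟩) (by simpa [underlyingMatrix] using A.coeff_ne_zero j)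

theorem ciSup_rankCompl_eq {A : LinearEquation} (hA : 2 ≤ A.length) (f : ℕ → ℕ → ℝ)
    (hf : ∀ w, 2 ≤ w → f w 1 ≤ f A.length 0) :
    ⨆ W : {W : Finset (Fin A.length) // 2 ≤ #W}, f #W.1 (rankCompl A.underlyingMatrix W.1) =
      f A.length 0 := by
  have huniv : 2 ≤ #(Finset.univ : Finset (Fin A.length)) := by simpa using hA
  have : Nonempty {W : Finset (Fin A.length) // 2 ≤ #W} := ⟨⟨_, huniv⟩⟩
  refine le_antisymm (ciSup_le fun ⟨W, hW⟩ => ?_)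
    (le_ciSup_of_le (Set.finite_range _).bddAbove ⟨_, huniv⟩ ?_)
  · obtain rfl | hproper := eq_or_ne W Finset.univ
    · simp [rankCompl_univ]
    · simpa only [A.rankCompl_of_ne_univ hproper] using hf _ hW
  · simp [rankCompl_univ]

variable {A B}

theorem m_eq (hA : 3 ≤ A.length) : A.m = ((A.length : ℝ) - 1) / (A.length - 2) := by
  have hk : (3 : ℝ) ≤ A.length := by exact_mod_cast hA
  have hsup := ciSup_rankCompl_eq (A := A) (by omega)
    (fun w ρ => ((w : ℝ) - 1) / ((w : ℝ) - 1 + (ρ : ℝ) - ((1 : ℕ) : ℝ))) fun w hw => by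
      have hw' : (2 : ℝ) ≤ w := by exact_mod_cast hw
      push_cast
      rw [add_sub_cancel_right, div_self (by linarith), le_div_iff₀ (by linarith)]
      linarith
  rw [m, matrixM, A.rankQ_underlyingMatrix (by omega), hsup]
  push_cast
  ring

theorem length_le_of_m_le (hA : 3 ≤ A.length) (hB : 3 ≤ B.length) (h : B.m ≤ A.m) :
    A.length ≤ B.length := by
  rw [m_eq hA, m_eq hB] at h
  have hk : (3 : ℝ) ≤ A.length := by exact_mod_cast hA
  have hl : (3 : ℝ) ≤ B.length := by exact_mod_cast hB
  rw [div_le_div_iff₀ (by linarith) (by linarith)] at h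
  have : (A.length : ℝ) ≤ B.length := by linarith
  exact_mod_cast this

theorem m₂_eq (hA : 3 ≤ A.length) (hAB : A.length ≤ B.length) :
    A.m₂ B = A.length / (A.length - 1 - 1 / ((B.length : ℝ) - 1)) := by
  have hk : (3 : ℝ) ≤ A.length := by exact_mod_cast hA
  have hkl : (A.length : ℝ) ≤ B.length := by exact_mod_cast hAB
  have hmB : 1 / matrixM B.underlyingMatrix = 1 - 1 / ((B.length : ℝ) - 1) := by
    have hl : (B.length : ℝ) - 1 ≠ 0 := by linarith
    rw [← m, m_eq (hA.trans hAB), one_div_div]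
    field_simp
    ring
  have hε : 0 < 1 / ((B.length : ℝ) - 1) := one_div_pos.2 (by linarith)
  have hlε : ((B.length : ℝ) - 1) * (1 / (B.length - 1)) = 1 := mul_one_div_cancel (by linarith)
  have hsup := ciSup_rankCompl_eq (A := A) (by omega)
    (fun w ρ => (w : ℝ) / ((w : ℝ) - 1 + (ρ : ℝ) - ((1 : ℕ) : ℝ) + 1 / matrixM B.underlyingMatrix))
    fun w hw => by
      have hw' : (2 : ℝ) ≤ w := by exact_mod_cast hw
      rw [hmB]
      generalize 1 / ((B.length : ℝ) - 1) = ε at hε hlε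
      push_cast
      rw [div_le_div_iff₀ (by nlinarith) (by nlinarith)]
      nlinarith [mul_le_mul_of_nonneg_right hw' hε.le, mul_le_mul_of_nonneg_right hkl hε.le]
  rw [m₂, matrixM₂, A.rankQ_underlyingMatrix (by omega), hsup, hmB]
  congr 1
  push_cast
  ring

theorem one_div_m₂_eq (hA : 3 ≤ A.length) (hAB : A.length ≤ B.length) :
    1 / A.m₂ B = 1 - (B.length : ℝ) / (A.length * (B.length - 1)) := by
  have hk : (3 : ℝ) ≤ A.length := by exact_mod_cast hA
  have hkl : (A.length : ℝ) ≤ B.length := by exact_mod_cast hAB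
  have hk0 : (A.length : ℝ) ≠ 0 := by linarith
  have hl0 : (B.length : ℝ) - 1 ≠ 0 := by linarith
  rw [m₂_eq hA hAB, one_div_div]
  field_simp
  ring

end LinearEquation

end Thresholds

section Limit

open Filter Topology MeasureTheory

theorem tendsto_polynomial_eval_mul_exp_neg (P : Polynomial ℝ) {δ : ℝ} (hδ : 0 < δ) :
    Tendsto (fun y : ℝ => P.eval y * Real.exp (-(δ * y))) atTop (𝓝 0) := by
  have hscaled := ((P.comp (Polynomial.C δ⁻¹ * Polynomial.X)).tendsto_div_exp_atTop).comp
    (tendsto_id.const_mul_atTop hδ)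
  refine hscaled.congr fun y => ?_
  simp only [Function.comp_apply, id, Polynomial.eval_comp, Polynomial.eval_mul,
    Polynomial.eval_C, Polynomial.eval_X]
  rw [inv_mul_cancel_left₀ hδ.ne', Real.exp_neg, div_eq_mul_inv]

theorem tendsto_polynomial_eval_ceil_log_mul_rpow_neg (P : Polynomial ℝ) {δ : ℝ} (hδ : 0 < δ) :
    Tendsto (fun n : ℕ => P.eval (⌈Real.log n⌉₊ : ℝ) * (n : ℝ) ^ (-δ)) atTop (𝓝 0) := by
  have hceil : Tendsto (fun n : ℕ => (⌈Real.log n⌉₊ : ℝ)) atTop atTop :=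
    tendsto_natCast_atTop_atTop.comp <| tendsto_nat_ceil_atTop.comp <|
      Real.tendsto_log_atTop.comp tendsto_natCast_atTop_atTop
  have hlim := (((tendsto_polynomial_eval_mul_exp_neg P hδ).comp hceil).norm).const_mul
    (Real.exp δ)
  rw [norm_zero, mul_zero] at hlim
  refine squeeze_zero_norm' ?_ hlim
  filter_upwards [eventually_ge_atTop 1] with n hn
  have hn0 : (0 : ℝ) < n := by exact_mod_cast hn
  have hlog : (⌈Real.log n⌉₊ : ℝ) ≤ Real.log n + 1 :=
    (Nat.ceil_lt_add_one (Real.log_natCast_nonneg n)).le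
  have hrpow : (n : ℝ) ^ (-δ) ≤ Real.exp δ * Real.exp (-(δ * ⌈Real.log n⌉₊)) := by
    rw [Real.rpow_def_of_pos hn0, ← Real.exp_add, Real.exp_le_exp]
    nlinarith
  rw [Function.comp_apply, norm_mul, norm_mul, Real.norm_of_nonneg (Real.exp_pos _).le,
    Real.norm_of_nonneg (Real.rpow_nonneg n.cast_nonneg (-δ)), mul_left_comm]
  gcongr

theorem tendsto_exp_neg_ceil_log_mul_rpow {ε : ℝ} (hε : ε < 1) :
    Tendsto (fun n : ℕ => Real.exp (-⌈Real.log n⌉₊) * (n : ℝ) ^ ε) atTop (𝓝 0) := by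
  have hlim : Tendsto (fun n : ℕ => (n : ℝ) ^ (-(1 - ε))) atTop (𝓝 0) :=
    (tendsto_rpow_neg_atTop (sub_pos.2 hε)).comp tendsto_natCast_atTop_atTop
  refine squeeze_zero' (.of_forall fun n => by positivity) ?_ hlim
  filter_upwards [eventually_ge_atTop 1] with n hn
  have hn0 : (0 : ℝ) < n := by exact_mod_cast hn
  rw [Real.rpow_def_of_pos hn0, Real.rpow_def_of_pos hn0, ← Real.exp_add, Real.exp_le_exp]
  linarith [Nat.le_ceil (Real.log n)]

variable {K : Bool → ℕ} {𝕜 : Type*} [Field 𝕜] {a : (τ : Bool) → Fin (K τ) → 𝕜} {k l : ℕ}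

theorem setOf_forall_exists_solution_subset {b : Bool → 𝕜} (ha : ∀ τ j, a τ j ≠ 0)
    (hK : ∀ τ, K τ = if τ then l else k) (hk : 3 ≤ k) (hkl : k ≤ l) {U : Set ℤ} (hU : U.Finite)
    (L : ℕ) :
    {S ∈ {S | ∀ χ : ℤ → Bool, ∃ e ∈ solutions a b S, ∀ j, χ (e.2 j) = e.1} | S ⊆ U} ⊆
      (⋃ j ∈ Finset.range (L + 1), {S | HasConfig a b k l (2 * l + 2) j (-1) S}) ∪
        ⋃ j ∈ Finset.Icc L (L + l), {S | HasConfig a b k l 0 j k S} := by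
  rintro S ⟨hsol, hSU⟩
  obtain ⟨j, hj, hconf⟩ | ⟨j, hj, hconf⟩ := exists_hasConfig ha hK hk hkl (hU.subset hSU) hsol L
  · exact .inl (Set.mem_biUnion (Finset.mem_range_succ_iff.2 hj) hconf)
  · exact .inr (Set.mem_biUnion hj hconf)

variable [CharZero 𝕜]

theorem exists_randomSubset_real_forall_exists_solution_le (b : Bool → 𝕜)
    (ha : ∀ τ j, a τ j ≠ 0) (hK : ∀ τ, K τ = if τ then l else k) (hk : 3 ≤ k) (hkl : k ≤ l) :
    ∃ H : ℕ, ∀ (L n : ℕ) (p : unitInterval), 1 ≤ n →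
      (p : ℝ) ≤ Real.exp (-1) / (2 * l * (l * l)) * (n : ℝ) ^ (-(1 - (l : ℝ) / (k * (l - 1)))) →
      (randomSubset n p).real
          {S | ∀ χ : ℤ → Bool, ∃ e ∈ solutions a b S, ∀ j, χ (e.2 j) = e.1} ≤
        (L + 1) * (H * (1 + 2 * (l * (3 + L + ↑(2 * l + 2) + 1)) ^ l) ^ (2 * l + 2) *
          (n : ℝ) ^ (-(1 / (k * (l - 1)) : ℝ))) +
        (l + 1) * (H * Real.exp (-L) * (n : ℝ) ^ (1 / (l - 1) : ℝ)) := by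
  obtain ⟨H, hH⟩ := exists_randomSubset_real_hasConfig_le (k := k) (l := l) a b (by omega)
    (by omega) fun τ => by rw [hK]; split_ifs <;> omega
  refine ⟨H, fun L n p hn hp => ?_⟩
  have hshort : ∀ j ∈ Finset.range (L + 1),
      (randomSubset n p).real {S | HasConfig a b k l (2 * l + 2) j (-1) S} ≤
        H * (1 + 2 * (l * (3 + L + ↑(2 * l + 2) + 1)) ^ l) ^ (2 * l + 2) *
          (n : ℝ) ^ (-(1 / (k * (l - 1)) : ℝ)) := fun j hj => by
    have hjL : (j : ℝ) ≤ L := by exact_mod_cast Finset.mem_range_succ_iff.1 hj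
    have hexp : Real.exp (-j) ≤ 1 := Real.exp_le_one_iff.2 (by simp)
    refine (hH (2 * l + 2) j (-1) n p hn hp).trans ?_
    rw [Int.cast_neg, Int.cast_one, neg_div]
    gcongr
    exact mul_le_of_le_one_right H.cast_nonneg hexp
  have hlong : ∀ j ∈ Finset.Icc L (L + l), (randomSubset n p).real {S | HasConfig a b k l 0 j k S} ≤
      H * Real.exp (-L) * (n : ℝ) ^ (1 / (l - 1) : ℝ) := fun j hj => by
    have hLj : (L : ℝ) ≤ j := by exact_mod_cast (Finset.mem_Icc.1 hj).1
    have hk0 : (k : ℝ) ≠ 0 := by norm_cast; omega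
    refine (hH 0 j k n p hn hp).trans ?_
    rw [pow_zero, mul_one, Int.cast_natCast, div_mul_cancel_left₀ hk0, one_div]
    gcongr
  rw [← randomSubset_real_inter_subsets]
  refine (measureReal_mono (setOf_forall_exists_solution_subset ha hK hk hkl (Set.finite_Icc _ _) L)
    (measure_ne_top _ _)).trans ((measureReal_union_le _ _).trans (add_le_add ?_ ?_))
  · refine (measureReal_biUnion_finset_le _ _).trans ((Finset.sum_le_sum hshort).trans_eq ?_)
    rw [Finset.sum_const, Finset.card_range, nsmul_eq_mul, Nat.cast_succ]
  · refine (measureReal_biUnion_finset_le _ _).trans ((Finset.sum_le_sum hlong).trans_eq ?_)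
    rw [Finset.sum_const, Nat.card_Icc, show L + l + 1 - L = l + 1 by omega, nsmul_eq_mul,
      Nat.cast_succ]

theorem tendsto_randomSubset_real_forall_exists_solution (b : Bool → 𝕜)
    (ha : ∀ τ j, a τ j ≠ 0) (hK : ∀ τ, K τ = if τ then l else k) (hk : 3 ≤ k) (hkl : k ≤ l)
    {p : ℕ → unitInterval} (hp : ∀ᶠ n : ℕ in atTop, (p n : ℝ) ≤
      Real.exp (-1) / (2 * l * (l * l)) * (n : ℝ) ^ (-(1 - (l : ℝ) / (k * (l - 1))))) :
    Tendsto (fun n => (randomSubset n (p n)).real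
      {S | ∀ χ : ℤ → Bool, ∃ e ∈ solutions a b S, ∀ j, χ (e.2 j) = e.1}) atTop (𝓝 0) := by
  obtain ⟨H, hH⟩ := exists_randomSubset_real_forall_exists_solution_le b ha hK hk hkl
  have hk' : (3 : ℝ) ≤ k := by exact_mod_cast hk
  have hl' : (3 : ℝ) ≤ l := by exact_mod_cast hk.trans hkl
  have hδ : 0 < 1 / ((k : ℝ) * (l - 1)) := one_div_pos.2 (mul_pos (by linarith) (by linarith))
  have hε : 1 / ((l : ℝ) - 1) < 1 := (div_lt_one (by linarith)).2 (by linarith)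
  have hshort := tendsto_polynomial_eval_ceil_log_mul_rpow_neg
    ((.X + 1) * (H * (1 + 2 * (l * (3 + .X + (2 * l + 2 : ℕ) + 1)) ^ l) ^ (2 * l + 2))) hδ
  have hlong := (tendsto_exp_neg_ceil_log_mul_rpow hε).const_mul ((l + 1 : ℝ) * H)
  refine squeeze_zero' (.of_forall fun n => measureReal_nonneg) ?_
    (by simpa only [mul_zero, add_zero] using hshort.add hlong)
  filter_upwards [hp, eventually_ge_atTop 1] with n hpn hn
  refine (hH ⌈Real.log n⌉₊ n (p n) hn hpn).trans_eq ?_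
  simp only [Polynomial.eval_mul, Polynomial.eval_add, Polynomial.eval_X, Polynomial.eval_natCast,
    Polynomial.eval_pow, Polynomial.eval_one, Polynomial.eval_ofNat]
  ring

/-- Apply the Rado property to a colouring with the colours `i₀` and `i₁` only. -/
theorem IsRado.exists_mem_solutions {r : ℕ} {A : Fin r → LinearEquation} {i₀ i₁ : Fin r}
    (hne : i₀ ≠ i₁) (hpos : ∀ i, 0 < (A i).length) {S : Set ℤ} (hS : IsRado A S) (χ : ℤ → Bool) :
    ∃ e ∈ solutions (K := fun τ => (A (if τ then i₁ else i₀)).length)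
        (fun τ j => ((A (if τ then i₁ else i₀)).coeff j : ℚ))
        (fun τ => ((A (if τ then i₁ else i₀)).const : ℚ)) S,
      ∀ j, χ (e.2 j) = e.1 := by
  obtain ⟨i, x, hinj, hsol, hχ⟩ := hS fun s => if χ s then i₁ else i₀
  obtain ⟨τ, hτ⟩ : ∃ τ, χ (x ⟨0, hpos i⟩) = τ := ⟨_, rfl⟩
  obtain rfl : (if τ then i₁ else i₀) = i := hτ ▸ hχ ⟨0, hpos i⟩
  have hite : Function.Injective fun τ : Bool => if τ then i₁ else i₀ :=
    Bool.injective_iff.2 (by simpa using hne)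
  refine ⟨⟨τ, fun j => x j⟩, ⟨Subtype.val_injective.comp hinj, fun j => (x j).2, ?_⟩,
    fun j => hite (hχ j)⟩
  have hcast := congrArg (Int.cast : ℤ → ℚ) hsol
  push_cast at hcast
  exact hcast

end Limit

end RandomRado

open Filter RandomRado in
theorem mainTheorem2_general {r : ℕ} (A : Fin r → LinearEquation) {i₀ i₁ : Fin r} (hne : i₀ ≠ i₁)
    (hpos : ∀ i, 0 < (A i).length) (h₀ : 3 ≤ (A i₀).length) (h₁ : 3 ≤ (A i₁).length)
    (hm : (A i₁).m ≤ (A i₀).m) :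
    ∃ c : ℝ, 0 < c ∧ ∀ p : ℕ → unitInterval,
      (∀ᶠ n : ℕ in atTop, (p n : ℝ) < c * (n : ℝ) ^ (-(1 / (A i₀).m₂ (A i₁)))) →
      Tendsto (fun n : ℕ => (randomSubset n (p n)).real {S | IsRado A S}) atTop (nhds 0) := by
  have hkl : (A i₀).length ≤ (A i₁).length := LinearEquation.length_le_of_m_le h₀ h₁ hm
  have : (0 : ℝ) < (A i₁).length := by exact_mod_cast hpos i₁
  refine ⟨Real.exp (-1) / (2 * (A i₁).length * ((A i₁).length * (A i₁).length)), by positivity,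
    fun p hp => ?_⟩
  rw [LinearEquation.one_div_m₂_eq h₀ hkl] at hp
  have hlim := tendsto_randomSubset_real_forall_exists_solution
    (a := fun τ j => ((A (if τ then i₁ else i₀)).coeff j : ℚ))
    (fun τ => ((A (if τ then i₁ else i₀)).const : ℚ))
    (fun τ j => Int.cast_ne_zero.2 ((A _).coeff_ne_zero j))
    (fun τ => apply_ite (fun i => (A i).length) _ _ _) h₀ hkl (hp.mono fun n hn => hn.le)
  exact squeeze_zero (fun n => MeasureTheory.measureReal_nonneg)
    (fun n => MeasureTheory.measureReal_mono (fun S hS => hS.exists_mem_solutions hne hpos)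
      (MeasureTheory.measure_ne_top _ _)) hlim

theorem mainTheorem2 (r : ℕ) (hr : 2 ≤ r) (A : Fin r → RandomRado.LinearEquation)
    (hhom : ∀ i, (A i).IsHomogeneous)
    (hirr : ∀ i, (A i).Irredundant)
    (hreg : ∀ i, (A i).PartitionRegular)
    (hlen : ∀ i, 3 ≤ (A i).length)
    (hanti : ∀ i j : Fin r, i ≤ j → (A j).m ≤ (A i).m) :
    ∃ c : ℝ, 0 < c ∧ ∀ p : ℕ → unitInterval,
      (∀ᶠ n : ℕ in Filter.atTop,
        (p n : ℝ) < c * (n : ℝ) ^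
          (-(1 / RandomRado.LinearEquation.m₂ (A ⟨0, by omega⟩) (A ⟨1, by omega⟩)))) →
      Filter.Tendsto
        (fun n : ℕ => (RandomRado.randomSubset n (p n)).real {S | RandomRado.IsRado A S})
        Filter.atTop (nhds 0) :=
  mainTheorem2_general A (by simp) (fun i => three_pos.trans_le (hlen i)) (hlen _) (hlen _)
    (hanti _ _ (by simp))
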